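/- Let $V$ be a real vector space of finite dimension $d$, and let $W$ be its dual space, with perfect pairing $\langle\cdot,\cdot\rangle : W\times V\to\mathbb{R}$. A polytope is a bounded polyhedron. Let $\mathbf a_1,\dots,\mathbf a_m\in W$. **Deformation cone.** Let $P_0=\{\mathbf x\in V:\langle \mathbf a_i,\mathbf x\rangle\le b_{0,i},\ 1\le i\le m\}$ be a full-dimensional polytope whose facets are, without repetition, the sets $F_i=\{\mathbf x\in P_0:\langle \mathbf a_i,\mathbf x\rangle=b_{0,i}\}$, $1\le i\le m$. (Facets are nonempty faces of dimension $d-1$; if $d=0$ there are none.) Then $\operatorname{Def}(P_0)$ is the set of the vectors $\mathbf b\in\mathbb{R}^m$ for which $Q=\{\mathbf x\in V:\langle \mathbf a_i,\mathbf x\rangle\le b_i,\ 1\le i\le m\}$ is a polytope and, for each vertex $v$ of $P_0$, the set $\{\mathbf x\in V:\langle \mathbf a_i,\mathbf x\rangle=b_i \text{ for all } i \text{ with } v\in F_i\}$ consists of one point, which is a vertex of $Q$. **Wall inequality.** Let $S,S'\subseteq\{1,\dots,m\}$ with $S\setminus S'=\{k\}$ and $S'\setminus S=\{k'\}$. A wall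 relation for $S,S'$ is a choice of real coefficients $c_i$ ($i\in S\cup S'$) with $c_k>0$, $c_{k'}>0$ and $$\sum_{i\in S\cap S'}c_i\,\mathbf a_i=c_k\,\mathbf a_k+c_{k'}\,\mathbf a_{k'}.$$ If it exists and is unique up to a common positive factor, the wall inequality of $S,S'$ for $\mathbf b\in\mathbb{R}^m$ is $$\sum_{i\in S\cap S'}c_i\,b_i\le c_k\,b_k+c_{k'}\,b_{k'}.$$ **(1) Polytopes.** Suppose that $P_0$ as above is simple (each vertex lies on exactly $d$ facets). For each edge $e=\{v,v'\}$ of $P_0$ (a one-dimensional face, with endpoints $v\ne v'$), each of the sets $S=\{i:v\in F_i\}$ and $S'=\{i:v'\in F_i\}$ has exactly one element that is not in the other, and $S,S'$ have a wall relation, unique up to a positive factor; let $I_e(\mathbf b)$ be its wall inequality. Then for all $\mathbf b\in\mathbb{R}^m$: $\mathbf b\in\operatorname{Def}(P_0)$ if and only if $I_e(\mathbf b)$ holds for every edge $e$ of $P_0$. **(2) Fans.** The normal cone of a polytope $P$ at a nonempty face $F$ is the set of all $\mathbf w\in W$ with $\langle \mathbf w,\mathbf x\rangle\ge\langle \mathbf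 w,\mathbf y\rangle$ for all $\mathbf x\in F$, $\mathbf y\in P$; the normal fan of $P$ is the set of its normal cones at all its nonempty faces; a fan is projective if it is the normal fan of a nonempty polytope, and simplicial if each of its cones is spanned by linearly independent vectors. Let $\Sigma_0$ be a simplicial projective fan in $W$ with $\{0\}\in\Sigma_0$, whose one-dimensional cones are generated, without repetition, by $\mathbf a_1,\dots,\mathbf a_m$. Let $\operatorname{Def}(\Sigma_0)=\operatorname{Def}(P_0)$ for a polytope $P_0$ as above (with these $\mathbf a_i$) whose normal fan is $\Sigma_0$. Such a $P_0$ exists and $\operatorname{Def}(P_0)$ does not depend on its choice. Call two maximal cones $\sigma,\sigma'$ of $\Sigma_0$ adjacent if each of the sets $S=\{i:\mathbf a_i\in\sigma\}$ and $S'=\{i:\mathbf a_i\in\sigma'\}$ has exactly one element that is not in the other. Then $S,S'$ have a wall relation, unique up to a positive factor; let $I_{\{\sigma,\sigma'\}}(\mathbf b)$ be its wall inequality. For all $\mathbf b\in\mathbb{R}^m$: $\mathbf b\in\operatorname{Def}(\Sigma_0)$ if and only if $I_{\{\sigma,\sigma'\}}(\mathbf b)$ holds for every pair $\{\sigma,\sigma'\}$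 of adjacent maximal cones of $\Sigma_0$. -/

import Mathlib

namespace DeformationCone

section Polytopes

variable {V W : Type*} [NormedAddCommGroup V] [NormedSpace ℝ V] [AddCommGroup W] [Module ℝ W]

/-- The polyhedron `{x ∈ V : ⟨a i, x⟩ ≤ b i for all i}`, where `⟨·,·⟩ = p` is the pairing of the
dual space `W` with `V`. -/
def polyhedron (p : W →ₗ[ℝ] V →ₗ[ℝ] ℝ) {m : ℕ} (a : Fin m → W) (b : Fin m → ℝ) : Set V :=
  {x | ∀ i, p (a i) x ≤ b i}

/-- A polytope is a bounded polyhedron. -/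
def IsPolytope (p : W →ₗ[ℝ] V →ₗ[ℝ] ℝ) (P : Set V) : Prop :=
  Bornology.IsBounded P ∧ ∃ (k : ℕ) (a : Fin k → W) (b : Fin k → ℝ), P = polyhedron p a b

/-- A nonempty face of `P`: the nonempty set of maximizers over `P` of a linear functional
(the zero functional gives `P` itself). -/
def IsFace (P F : Set V) : Prop := F.Nonempty ∧ IsExposed ℝ P F

/-- The dimension of (the affine hull of) a nonempty set. -/
noncomputable def dim (F : Set V) : ℕ := Module.finrank ℝ (vectorSpan ℝ F)

/-- A facet of `P`: a nonempty face of codimension one. -/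
def IsFacet (P F : Set V) : Prop := IsFace P F ∧ dim F + 1 = dim P

/-- A vertex of `P`: a face that consists of a single point. -/
def IsVertex (P : Set V) (v : V) : Prop := IsFace P {v}

/-- `{v, v'}` is an edge of the polytope `P`: the segment from `v` to `v'` is a one-dimensional
face. (Every one-dimensional face of a polytope is the segment between two distinct vertices.) -/
def IsEdge (P : Set V) (v v' : V) : Prop := v ≠ v' ∧ IsFace P (segment ℝ v v')

/-- A `k`-dimensional polytope is simple if each vertex lies on exactly `k` facets. -/
def IsSimple (P : Set V) : Prop :=
  ∀ v, IsVertex P v → {F : Set V | IsFacet P F ∧ v ∈ F}.ncard = dim P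

/-- The set `{x ∈ P : ⟨a i, x⟩ = b i}`, for `P` the polyhedron defined by `a` and `b`. -/
def facet (p : W →ₗ[ℝ] V →ₗ[ℝ] ℝ) {m : ℕ} (a : Fin m → W) (b : Fin m → ℝ) (i : Fin m) : Set V :=
  {x ∈ polyhedron p a b | p (a i) x = b i}

/-- The system `⟨a i, x⟩ ≤ b₀ i` defines a full-dimensional polytope, each inequality is
facet-defining, and the sets `facet p a b₀ i` are the facets of the polytope, without repetition. -/
structure IsFacetDescription (p : W →ₗ[ℝ] V →ₗ[ℝ] ℝ) {m : ℕ} (a : Fin m → W) (b₀ : Fin m → ℝ) :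
    Prop where
  bounded : Bornology.IsBounded (polyhedron p a b₀)
  full_dimensional : affineSpan ℝ (polyhedron p a b₀) = ⊤
  injective : Function.Injective (facet p a b₀)
  range_eq : Set.range (facet p a b₀) = {F | IsFacet (polyhedron p a b₀) F}

/-- `b` is a deforming vector for `Q`, seen as a deformation of the polytope `P₀` given by `a` and
`b₀`: the system `⟨a i, x⟩ ≤ b i` defines `Q`, and for each vertex `v` of `P₀` the hyperplanes
`⟨a i, x⟩ = b i`, for the facets `i` of `P₀` that contain `v`, intersect in a vertex of `Q`. -/
def IsDeformingVector (p : W →ₗ[ℝ] V →ₗ[ℝ] ℝ) {m : ℕ} (a : Fin m → W) (b₀ : Fin m → ℝ)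
    (Q : Set V) (b : Fin m → ℝ) : Prop :=
  Q = polyhedron p a b ∧
    ∀ v, IsVertex (polyhedron p a b₀) v →
      ∃ u, IsVertex Q u ∧ {x | ∀ i, v ∈ facet p a b₀ i → p (a i) x = b i} = {u}

/-- The deformation cone of the polytope given by `a` and `b₀`: the set of the deforming vectors of
all the polytopes that are deformations of it. -/
def deformationCone (p : W →ₗ[ℝ] V →ₗ[ℝ] ℝ) {m : ℕ} (a : Fin m → W) (b₀ : Fin m → ℝ) :
    Set (Fin m → ℝ) :=
  {b | ∃ Q, IsPolytope p Q ∧ IsDeformingVector p a b₀ Q b}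

open scoped Classical in
/-- The (indices of the) supporting facets of the point `v`. -/
noncomputable def supportingFacets (p : W →ₗ[ℝ] V →ₗ[ℝ] ℝ) {m : ℕ} (a : Fin m → W)
    (b₀ : Fin m → ℝ) (v : V) : Finset (Fin m) :=
  {i | v ∈ facet p a b₀ i}

end Polytopes

section Walls

variable {W : Type*} [AddCommGroup W] [Module ℝ W]

/-- Let `S = {F, i₁, …, i_{d-1}}` and `S' = {F', i₁, …, i_{d-1}}` be two index sets that differ in
one element. The coefficients `c`, supported on `S ∪ S'`, satisfy
`∑ j, c (i_j) • a (i_j) = c F • a F + c F' • a F'` with `c F > 0` and `c F' > 0`. -/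
structure IsWallRelation {m : ℕ} (a : Fin m → W) (S S' : Finset (Fin m)) (F F' : Fin m)
    (c : Fin m → ℝ) : Prop where
  sdiff_eq : S \ S' = {F}
  sdiff_eq' : S' \ S = {F'}
  support : ∀ i, i ∉ S ∪ S' → c i = 0
  pos : 0 < c F
  pos' : 0 < c F'
  relation : ∑ i ∈ S ∩ S', c i • a i = c F • a F + c F' • a F'

/-- There is a wall relation for `S` and `S'`, and it is unique up to a positive factor. -/
def HasUniqueWallRelation {m : ℕ} (a : Fin m → W) (S S' : Finset (Fin m)) : Prop :=
  ∃ F F' c, IsWallRelation a S S' F F' c ∧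
    ∀ G G' c', IsWallRelation a S S' G G' c' → G = F ∧ G' = F' ∧ ∃ t : ℝ, 0 < t ∧ c' = t • c

/-- The wall inequality `∑ j, c (i_j) * b (i_j) ≤ c F * b F + c F' * b F'` that belongs to the wall
relation of `S` and `S'`. It does not depend on the positive factor. -/
def WallInequality {m : ℕ} (a : Fin m → W) (S S' : Finset (Fin m)) (b : Fin m → ℝ) : Prop :=
  ∀ F F' c, IsWallRelation a S S' F F' c →
    ∑ i ∈ S ∩ S', c i * b i ≤ c F * b F + c F' * b F'

end Walls

section Fans

variable {V W : Type*} [NormedAddCommGroup V] [NormedSpace ℝ V] [AddCommGroup W] [Module ℝ W]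

/-- The normal cone of `P` at its face `F`: the `w ∈ W` that attain their maximum over `P` at all
points of `F`. -/
def normalCone (p : W →ₗ[ℝ] V →ₗ[ℝ] ℝ) (F P : Set V) : PointedCone ℝ W where
  carrier := {w | ∀ x ∈ F, ∀ y ∈ P, p w y ≤ p w x}
  add_mem' := by
    intro w w' hw hw' x hx y hy
    simpa using add_le_add (hw x hx y hy) (hw' x hx y hy)
  zero_mem' := by
    intro x _ y _
    simp
  smul_mem' := by
    rintro ⟨t, ht⟩ w hw x hx y hy
    change p (t • w) y ≤ p (t • w) x
    simpa using mul_le_mul_of_nonneg_left (hw x hx y hy) ht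

/-- The normal fan of `P`: the set of the normal cones of `P` at all its nonempty faces. -/
def normalFan (p : W →ₗ[ℝ] V →ₗ[ℝ] ℝ) (P : Set V) : Set (PointedCone ℝ W) :=
  {σ | ∃ F, IsFace P F ∧ σ = normalCone p F P}

/-- A fan is projective if it is the normal fan of a (nonempty) polytope. -/
def IsProjectiveFan (p : W →ₗ[ℝ] V →ₗ[ℝ] ℝ) (fan : Set (PointedCone ℝ W)) : Prop :=
  ∃ P : Set V, P.Nonempty ∧ IsPolytope p P ∧ fan = normalFan p P

/-- A fan is simplicial if each of its cones is, that is, is spanned by linearly independent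
vectors. -/
def IsSimplicialFan (fan : Set (PointedCone ℝ W)) : Prop :=
  ∀ σ ∈ fan, σ.IsSimplicial

/-- The vectors `a i` generate the one-dimensional cones of the fan, each of them once. -/
structure AreRayGenerators {m : ℕ} (fan : Set (PointedCone ℝ W)) (a : Fin m → W) : Prop where
  injective : Function.Injective fun i => PointedCone.hull ℝ {a i}
  range_eq : (Set.range fun i => PointedCone.hull ℝ {a i}) =
    {σ ∈ fan | Module.finrank ℝ (Submodule.span ℝ (σ : Set W)) = 1}

/-- The deformation cone of a fan with ray generators `a`: the deformation cone of a full-dimensional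
polytope with this normal fan and with facet normals `a`. -/
def fanDeformationCone (p : W →ₗ[ℝ] V →ₗ[ℝ] ℝ) {m : ℕ} (fan : Set (PointedCone ℝ W))
    (a : Fin m → W) : Set (Fin m → ℝ) :=
  {b | ∃ b₀, IsFacetDescription p a b₀ ∧ normalFan p (polyhedron p a b₀) = fan ∧
    b ∈ deformationCone p a b₀}

open scoped Classical in
/-- The (indices of the) spanning rays of a cone `σ` of a fan with ray generators `a`. (In a fan, the
rays that lie in `σ` are the one-dimensional faces of `σ`.) -/
noncomputable def spanningRays {m : ℕ} (a : Fin m → W) (σ : PointedCone ℝ W) : Finset (Fin m) :=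
  {i | a i ∈ σ}

/-- Two maximal cones of the fan are adjacent if their sets of spanning rays differ by exactly one
ray. -/
def AreAdjacent {m : ℕ} (fan : Set (PointedCone ℝ W)) (a : Fin m → W) (σ σ' : PointedCone ℝ W) :
    Prop :=
  Maximal (· ∈ fan) σ ∧ Maximal (· ∈ fan) σ' ∧
    (spanningRays a σ \ spanningRays a σ').card = 1 ∧
    (spanningRays a σ' \ spanningRays a σ).card = 1

end Fans

end DeformationCone

open DeformationCone

/-! At a simple vertex `v` of the polytope of `b₀`, the normals of the facets through `v` form a
basis of `W`. So for every `b` the displaced hyperplanes `p (a i) x = b i` of these facets meet in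
exactly one point `u v`. Boundedness does not depend on the right-hand side
(`isBounded_polyhedron_of_isBounded`), so `b` lies in the deformation cone if and only if every `u
v` satisfies all the inequalities of `b`.

An edge `{v, v'}` exchanges one facet `k` for another facet `k'`. The wall relation is the expansion
of `a k'` in the basis at `v`, with signs read off by pairing with `v' - v`
(`hasUniqueWallRelation`). Paired with `u v`, the wall inequality becomes `p (a k') (u v) ≤ b k'`
(`wallInequality_iff`). This gives necessity. Sufficiency passes from local to global
(`pairing_le_of_forall_isEdge`): among the vertices `v` whose `u v` violates inequality `j`, take
one with `p (a j) v` maximal. The simplex step `IsVertex.exists_isEdge_lt` leads to a neighbour `v'`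
where `p (a j)` is larger, so that `u v'` satisfies `j`. The wall inequality makes `u v' - u v` a
nonnegative multiple of `v' - v`, hence `p (a j) (u v) ≤ p (a j) (u v') ≤ b j`, a contradiction.

A fan reduces to a polytope: its ray generators are facet normals of a polytope with this normal fan
(`exists_isFacetDescription`), since a face and its normal cone have complementary dimensions.
Maximal cones are the normal cones at vertices, simplicial ones belong to simple vertices, and
adjacent ones to the ends of an edge. -/

namespace DeformationCone

/-! ### Faces, edges and boundedness of polyhedra. -/

section Polyhedra

variable {V W : Type*} [NormedAddCommGroup V] [NormedSpace ℝ V] [AddCommGroup W] [Module ℝ W]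
  (p : W →ₗ[ℝ] V →ₗ[ℝ] ℝ) {m : ℕ} {a : Fin m → W} {b b₀ : Fin m → ℝ}

theorem mem_supportingFacets {v : V} {i : Fin m} :
    i ∈ supportingFacets p a b v ↔ v ∈ polyhedron p a b ∧ p (a i) v = b i := by
  classical
  rw [supportingFacets, Finset.mem_filter_univ]
  rfl

theorem convex_polyhedron (a : Fin m → W) (b : Fin m → ℝ) : Convex ℝ (polyhedron p a b) := by
  have : polyhedron p a b = ⋂ i, {x | p (a i) x ≤ b i} := by
    ext x; simp [polyhedron]
  rw [this]
  exact convex_iInter fun i => convex_halfSpace_le (p (a i)).isLinear (b i)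

/-- From a point of a polyhedron one can move a little in each direction along which no active
constraint increases. -/
theorem exists_pos_add_smul_mem {x z : V} (hx : x ∈ polyhedron p a b)
    (hz : ∀ i ∈ supportingFacets p a b x, p (a i) z ≤ 0) :
    ∃ ε : ℝ, 0 < ε ∧ ∀ t, 0 ≤ t → t ≤ ε → x + t • z ∈ polyhedron p a b := by
  -- Active constraints do not increase along `z`, the others have slack. There are finitely many,
  -- so one `ε` serves all.
  have key : ∀ i, ∀ᶠ ε : ℝ in nhdsWithin 0 (Set.Ioi 0), p (a i) x + ε * p (a i) z ≤ b i := by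
    intro i
    by_cases hi : i ∈ supportingFacets p a b x
    · have h1 := ((mem_supportingFacets p).1 hi).2
      filter_upwards [self_mem_nhdsWithin] with ε (hε : 0 < ε)
      nlinarith [hz i hi]
    · have h1 : p (a i) x < b i := lt_of_le_of_ne (hx i) fun h =>
        hi ((mem_supportingFacets p).2 ⟨hx, h⟩)
      have h2 : Filter.Tendsto (fun ε : ℝ => p (a i) x + ε * p (a i) z) (nhds 0)
          (nhds (p (a i) x)) := by
        have : Continuous fun ε : ℝ => p (a i) x + ε * p (a i) z := by fun_prop
        simpa using this.tendsto 0
      exact ((h2.eventually_lt_const h1).filter_mono nhdsWithin_le_nhds).mono fun _ h => h.le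
  obtain ⟨ε, h1, h2⟩ := ((Filter.eventually_all.2 key).and self_mem_nhdsWithin).exists
  have h2 : 0 < ε := h2
  have hε : x + ε • z ∈ polyhedron p a b := fun i => by simpa using h1 i
  refine ⟨ε, h2, fun t ht htε => ?_⟩
  have := (convex_polyhedron p a b).add_smul_sub_mem hx hε (t := t / ε)
    ⟨by positivity, (div_le_one h2).2 htε⟩
  have e : t / ε * ε = t := by field_simp
  simpa [smul_smul, e] using this

/-- A functional that is maximal at `x` vanishes on the common kernel of the constraints that are
active at `x`. -/
theorem pairing_eq_zero_of_isMax {x z : V} {w : W} (hx : x ∈ polyhedron p a b)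
    (hw : ∀ y ∈ polyhedron p a b, p w y ≤ p w x)
    (hz : ∀ i ∈ supportingFacets p a b x, p (a i) z = 0) : p w z = 0 := by
  obtain ⟨ε, hε, h⟩ := exists_pos_add_smul_mem p hx fun i hi => (hz i hi).le
  obtain ⟨δ, hδ, h'⟩ := exists_pos_add_smul_mem p (z := -z) hx fun i hi => by simp [hz i hi]
  have h1 := hw _ (h ε hε.le le_rfl)
  have h2 := hw _ (h' δ hδ.le le_rfl)
  simp only [map_add, map_smul, map_neg, smul_eq_mul, add_le_iff_nonpos_right] at h1 h2
  apply le_antisymm <;> nlinarith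

/-- The points of a polyhedron at which given constraints are active form a face. -/
theorem isFace_setOf_eq [FiniteDimensional ℝ V] (I : Finset (Fin m))
    (hne : ∃ x ∈ polyhedron p a b, ∀ i ∈ I, p (a i) x = b i) :
    IsFace (polyhedron p a b) {x ∈ polyhedron p a b | ∀ i ∈ I, p (a i) x = b i} := by
  obtain ⟨x, hx, hxI⟩ := hne
  -- The sum of the chosen normals is bounded by the sum of their `b i`. The bound is attained at
  -- `x`, so a maximizer must attain each summand.
  refine ⟨⟨x, hx, hxI⟩, fun _ => ⟨LinearMap.toContinuousLinearMap (p (∑ i ∈ I, a i)), ?_⟩⟩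
  ext y
  simp only [Set.mem_ofPred_eq, LinearMap.coe_toContinuousLinearMap', and_congr_right_iff]
  intro hy
  have hs : ∀ z, p (∑ i ∈ I, a i) z = ∑ i ∈ I, p (a i) z := fun z => by
    rw [map_sum, LinearMap.sum_apply]
  simp only [hs]
  constructor
  · intro h z hz
    exact Finset.sum_le_sum fun i hi => (hz i).trans (h i hi).ge
  · intro h
    have h1 := h x hx
    have h2 : ∑ i ∈ I, p (a i) y = ∑ i ∈ I, b i :=
      le_antisymm (Finset.sum_le_sum fun i _ => hy i)
        ((Finset.sum_congr rfl hxI).symm.le.trans h1)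
    exact (Finset.sum_eq_sum_iff_of_le fun i _ => hy i).1 h2

theorem IsVertex.mem {P : Set V} {v : V} (h : IsVertex P v) : v ∈ P := by
  obtain ⟨l, hl⟩ := h.2 h.1
  have : v ∈ ({v} : Set V) := rfl
  rw [hl] at this
  exact this.1

theorem IsEdge.symm {P : Set V} {v v' : V} (h : IsEdge P v v') : IsEdge P v' v :=
  ⟨h.1.symm, by rw [segment_symm]; exact h.2⟩

/-- If the common kernel of the constraints that are active at both `v` and `v'` is a line, and each
of `v` and `v'` has another active constraint, then `{v, v'}` is an edge. -/
theorem isEdge_of_forall_exists_eq_smul [FiniteDimensional ℝ V] {v v' : V} {I : Finset (Fin m)} {k k' : Fin m}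
    (hk : k ∈ supportingFacets p a b v) (hk' : k' ∈ supportingFacets p a b v')
    (hkv' : k ∉ supportingFacets p a b v') (hkv : k' ∉ supportingFacets p a b v)
    (hI : I ⊆ supportingFacets p a b v) (hI' : I ⊆ supportingFacets p a b v')
    (h : ∀ z, (∀ i ∈ I, p (a i) z = 0) → ∃ t : ℝ, z = t • (v' - v)) :
    IsEdge (polyhedron p a b) v v' := by
  rw [mem_supportingFacets] at hk hk' hkv hkv'
  have hv := hk.1
  have hv' := hk'.1
  have e1 : p (a k) (v' - v) < 0 := by
    rw [map_sub, sub_neg, hk.2]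
    exact lt_of_le_of_ne (hv' k) fun h => hkv' ⟨hv', h⟩
  have e2 : 0 < p (a k') (v' - v) := by
    rw [map_sub, sub_pos, hk'.2]
    exact lt_of_le_of_ne (hv k') fun h => hkv ⟨hv, h⟩
  have hIv : ∀ i ∈ I, p (a i) v = b i := fun i hi => ((mem_supportingFacets p).1 (hI hi)).2
  have hIv' : ∀ i ∈ I, p (a i) v' = b i := fun i hi => ((mem_supportingFacets p).1 (hI' hi)).2
  refine ⟨?_, ?_⟩
  · rintro rfl
    simp at e1
  · have h1 := isFace_setOf_eq p I ⟨v, hv, hIv⟩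
    convert h1 using 1
    ext x
    constructor
    · intro hx
      refine ⟨(convex_polyhedron p a b).segment_subset hv hv' hx, fun i hi => ?_⟩
      rw [segment_eq_image'] at hx
      obtain ⟨s, -, rfl⟩ := hx
      simp [hIv i hi, hIv' i hi]
    · rintro ⟨hx, hxI⟩
      obtain ⟨t, ht⟩ := h (x - v) fun i hi => by rw [map_sub, hxI i hi, hIv i hi, sub_self]
      obtain rfl : x = v + t • (v' - v) := by rw [← ht]; abel
      rw [segment_eq_image']
      -- Constraint `k` cuts the line off before `v`, constraint `k'` beyond `v'`.
      refine ⟨t, ⟨?_, ?_⟩, rfl⟩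
      · have := hx k
        rw [map_add, map_smul, hk.2, smul_eq_mul] at this
        nlinarith
      · have := hx k'
        have e3 : p (a k') v = b k' - p (a k') (v' - v) := by rw [map_sub, hk'.2]; ring
        rw [map_add, map_smul, e3, smul_eq_mul] at this
        nlinarith

theorem isClosed_polyhedron [FiniteDimensional ℝ V] (a : Fin m → W) (b : Fin m → ℝ) : IsClosed (polyhedron p a b) := by
  have : polyhedron p a b = ⋂ i, {x | p (a i) x ≤ b i} := by
    ext x; simp [polyhedron]
  rw [this]
  exact isClosed_iInter fun i =>
    isClosed_le (LinearMap.continuous_of_finiteDimensional _) continuous_const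

/-- Boundedness of a nonempty polyhedron passes on to all polyhedra with the same normals. -/
theorem isBounded_polyhedron_of_isBounded [FiniteDimensional ℝ V]
    (h : Bornology.IsBounded (polyhedron p a b₀))
    (hne : (polyhedron p a b₀).Nonempty) (b : Fin m → ℝ) :
    Bornology.IsBounded (polyhedron p a b) := by
  obtain ⟨x₀, hx₀⟩ := hne
  -- The recession cone is the same for all right-hand sides. It is zero because `x₀ + t • z` would
  -- stay in the bounded polyhedron for all `t ≥ 0`; a displacement of length `2 * C + 1` is already
  -- too long.
  have hrec : ∀ z, (∀ i, p (a i) z ≤ 0) → z = 0 := by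
    intro z hz
    by_contra hz0
    obtain ⟨C, hC⟩ := h.exists_norm_le
    have hmem : ∀ t : ℝ, 0 ≤ t → x₀ + t • z ∈ polyhedron p a b₀ := fun t ht i => by
      rw [map_add, map_smul, smul_eq_mul]
      nlinarith [hz i, hx₀ i, mul_nonneg ht (neg_nonneg.2 (hz i))]
    have hpos : 0 < ‖z‖ := norm_pos_iff.2 hz0
    have hC0 : 0 ≤ C := (norm_nonneg _).trans (hC x₀ hx₀)
    have h0 : 0 ≤ (2 * C + 1) / ‖z‖ := by positivity
    have h1 := hC _ (hmem _ h0)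
    have h2 : ‖((2 * C + 1) / ‖z‖) • z‖ = 2 * C + 1 := by
      rw [norm_smul, Real.norm_of_nonneg h0]
      field_simp
    have h3 := norm_sub_le (x₀ + ((2 * C + 1) / ‖z‖) • z) x₀
    rw [add_sub_cancel_left, h2] at h3
    linarith [hC x₀ hx₀]
  -- This positively homogeneous function vanishes only at `0`. With its minimum `δ` on the unit
  -- sphere, `‖x‖ * δ ≤ ∑ i, max (b i) 0` on the polyhedron.
  have hcont : Continuous fun z : V => ∑ i, max (p (a i) z) 0 :=
    continuous_finsetSum _ fun i _ =>
      (LinearMap.continuous_of_finiteDimensional (p (a i))).max continuous_const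
  by_cases hs : (Metric.sphere (0 : V) 1).Nonempty
  · obtain ⟨z, hz, hmin⟩ := (isCompact_sphere (0 : V) 1).exists_isMinOn hs hcont.continuousOn
    set δ := ∑ i, max (p (a i) z) 0 with hδ
    have hδ0 : 0 < δ := by
      refine lt_of_le_of_ne (Finset.sum_nonneg fun i _ => le_max_right _ _) fun h0 => ?_
      have h1 := (Finset.sum_eq_zero_iff_of_nonneg fun i _ => le_max_right _ _).1 h0.symm
      have h2 := hrec z fun i => (le_max_left _ _).trans (h1 i (Finset.mem_univ i)).le
      simp [h2] at hz
    refine isBounded_iff_forall_norm_le.2 ⟨(∑ i, max (b i) 0) / δ, fun x hx => ?_⟩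
    rw [le_div_iff₀ hδ0]
    have hx' : ∑ i, max (p (a i) x) 0 ≤ ∑ i, max (b i) 0 :=
      Finset.sum_le_sum fun i _ => max_le_max (hx i) le_rfl
    refine le_trans ?_ hx'
    rcases eq_or_ne x 0 with rfl | hx0
    · simp
    have hn : 0 < ‖x‖ := norm_pos_iff.2 hx0
    have h1 : ‖x‖⁻¹ • x ∈ Metric.sphere (0 : V) 1 := by simp [norm_smul, hn.ne']
    have h2 : δ ≤ ∑ i, max (p (a i) (‖x‖⁻¹ • x)) 0 := hmin h1
    have h3 : ∑ i, max (p (a i) (‖x‖⁻¹ • x)) 0 = ‖x‖⁻¹ * ∑ i, max (p (a i) x) 0 := by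
      rw [Finset.mul_sum]
      refine Finset.sum_congr rfl fun i _ => ?_
      rw [map_smul, smul_eq_mul, mul_max_of_nonneg _ _ (by positivity), mul_zero]
    rw [h3, inv_mul_eq_div, le_div_iff₀ hn] at h2
    linarith
  · refine isBounded_iff_forall_norm_le.2 ⟨0, fun x _ => ?_⟩
    by_contra hx
    have hn : 0 < ‖x‖ := not_le.1 hx
    exact hs ⟨‖x‖⁻¹ • x, by simp [norm_smul, hn.ne']⟩

theorem finrank_eq_of_isPerfPair (p : W →ₗ[ℝ] V →ₗ[ℝ] ℝ) [p.IsPerfPair] : Module.finrank ℝ W = Module.finrank ℝ V := by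
  rw [(LinearEquiv.ofBijective p (LinearMap.IsPerfPair.bijective_left p)).finrank_eq]
  exact Subspace.dual_finrank_eq

/-! ### Vertices and edges in terms of kernels of active constraints. -/

section PerfectPairing

variable [FiniteDimensional ℝ V] [p.IsPerfPair]

theorem finiteDimensional_of_isPerfPair (p : W →ₗ[ℝ] V →ₗ[ℝ] ℝ) [p.IsPerfPair] : FiniteDimensional ℝ W :=
  (LinearEquiv.ofBijective p (LinearMap.IsPerfPair.bijective_left p)).symm.finiteDimensional

/-- Surjectivity of the perfect pairing makes every exposing functional an element of `W`. -/
theorem isFace_iff {P F : Set V} : IsFace P F ↔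
    F.Nonempty ∧ ∃ w : W, F = {x ∈ P | ∀ y ∈ P, p w y ≤ p w x} := by
  constructor
  · rintro ⟨h, h'⟩
    obtain ⟨l, hl⟩ := h' h
    obtain ⟨w, hw⟩ := (LinearMap.IsPerfPair.bijective_left p).2 (l : V →ₗ[ℝ] ℝ)
    refine ⟨h, w, ?_⟩
    rw [hw]
    exact hl
  · rintro ⟨h, w, hw⟩
    exact ⟨h, fun _ => ⟨LinearMap.toContinuousLinearMap (p w), hw⟩⟩

/-- A functional that vanishes on a common kernel is a linear combination. -/
theorem mem_span_of_forall_pairing_eq_zero {s : Set W} {w : W}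
    (h : ∀ z, (∀ i ∈ s, p i z = 0) → p w z = 0) : w ∈ Submodule.span ℝ s := by
  have h1 : p w ∈ Submodule.span ℝ (Set.range fun i : s => p i) := by
    apply FiniteDimensional.mem_span_of_iInf_ker_le_ker
    intro z hz
    simp only [Submodule.mem_iInf, LinearMap.mem_ker] at hz ⊢
    exact h z fun i hi => hz ⟨i, hi⟩
  have h2 : (Set.range fun i : s => p i) = p '' s := by
    ext; simp
  rw [h2, Submodule.span_image] at h1
  obtain ⟨w', hw', h3⟩ := h1
  rwa [← (LinearMap.IsPerfPair.bijective_left p).1 h3]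

/-- A point of a polyhedron is a vertex if and only if the active constraints have trivial common
kernel. -/
theorem isVertex_iff {v : V} : IsVertex (polyhedron p a b) v ↔
    v ∈ polyhedron p a b ∧ ∀ z, (∀ i ∈ supportingFacets p a b v, p (a i) z = 0) → z = 0 := by
  constructor
  · intro h
    obtain ⟨-, w, hw⟩ := (isFace_iff p).1 h
    have hv : v ∈ polyhedron p a b ∧ ∀ y ∈ polyhedron p a b, p w y ≤ p w v := by
      have : v ∈ ({v} : Set V) := rfl
      rwa [hw] at this
    refine ⟨hv.1, fun z hz => ?_⟩
    have h0 := pairing_eq_zero_of_isMax p hv.1 hv.2 hz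
    obtain ⟨ε, hε, h1⟩ := exists_pos_add_smul_mem p hv.1 fun i hi => (hz i hi).le
    have : v + ε • z ∈ ({v} : Set V) := by
      rw [hw]
      exact ⟨h1 ε hε.le le_rfl, fun y hy => by simpa [h0] using hv.2 y hy⟩
    simpa [hε.ne'] using this
  · rintro ⟨hv, h⟩
    have h1 := isFace_setOf_eq p (supportingFacets p a b v)
      ⟨v, hv, fun i hi => ((mem_supportingFacets p).1 hi).2⟩
    have h2 : {x ∈ polyhedron p a b | ∀ i ∈ supportingFacets p a b v, p (a i) x = b i} = {v} := by
      ext x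
      simp only [Set.mem_ofPred_eq, Set.mem_singleton_iff]
      constructor
      · rintro ⟨-, hx⟩
        refine sub_eq_zero.1 (h _ fun i hi => ?_)
        rw [map_sub, hx i hi, ((mem_supportingFacets p).1 hi).2, sub_self]
      · rintro rfl
        exact ⟨hv, fun i hi => ((mem_supportingFacets p).1 hi).2⟩
    rwa [h2] at h1

theorem IsVertex.span_eq_top {v : V} (h : IsVertex (polyhedron p a b) v) :
    Submodule.span ℝ (a '' (supportingFacets p a b v : Set (Fin m))) = ⊤ := by
  rw [eq_top_iff]
  intro w _
  apply mem_span_of_forall_pairing_eq_zero p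
  intro z hz
  rw [((isVertex_iff p).1 h).2 z fun i hi => hz _ ⟨i, hi, rfl⟩, map_zero]

theorem IsVertex.finrank_le_card {v : V} (h : IsVertex (polyhedron p a b) v) :
    Module.finrank ℝ V ≤ (supportingFacets p a b v).card := by
  classical
  rw [← finrank_eq_of_isPerfPair p, ← finrank_top, ← h.span_eq_top p, ← Finset.coe_image]
  exact (finrank_span_finset_le_card _).trans Finset.card_image_le

/-- The vertices of a polyhedron are finite in number. -/
theorem finite_setOf_isVertex (a : Fin m → W) (b : Fin m → ℝ) :
    {v | IsVertex (polyhedron p a b) v}.Finite := by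
  refine Set.Finite.of_finite_image (f := supportingFacets p a b) (Set.toFinite _) ?_
  intro v hv v' hv' h
  refine sub_eq_zero.1 (((isVertex_iff p).1 hv).2 _ fun i hi => ?_)
  have hi' := hi
  rw [h] at hi'
  rw [map_sub, ((mem_supportingFacets p).1 hi).2, ((mem_supportingFacets p).1 hi').2, sub_self]

/-- An end of an edge is a vertex. -/
theorem IsEdge.isVertex_left {v v' : V} (h : IsEdge (polyhedron p a b) v v') :
    IsVertex (polyhedron p a b) v := by
  obtain ⟨hne, hf⟩ := h
  obtain ⟨-, w, hw⟩ := (isFace_iff p).1 hf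
  have hv : v ∈ polyhedron p a b ∧ ∀ y ∈ polyhedron p a b, p w y ≤ p w v := by
    have : v ∈ segment ℝ v v' := left_mem_segment ℝ v v'
    rwa [hw] at this
  refine (isVertex_iff p).2 ⟨hv.1, fun z hz => ?_⟩
  have h0 := pairing_eq_zero_of_isMax p hv.1 hv.2 hz
  obtain ⟨ε, hε, h1⟩ := exists_pos_add_smul_mem p hv.1 fun i hi => (hz i hi).le
  obtain ⟨δ, hδ, h2⟩ := exists_pos_add_smul_mem p (z := -z) hv.1 fun i hi => by simp [hz i hi]
  have h3 : v + ε • z ∈ segment ℝ v v' := by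
    rw [hw]
    exact ⟨h1 ε hε.le le_rfl, fun y hy => by simpa [h0] using hv.2 y hy⟩
  have h4 : v + δ • (-z) ∈ segment ℝ v v' := by
    rw [hw]
    exact ⟨h2 δ hδ.le le_rfl, fun y hy => by simpa [h0] using hv.2 y hy⟩
  rw [segment_eq_image'] at h3 h4
  obtain ⟨s, ⟨hs, -⟩, h3⟩ := h3
  obtain ⟨t, ⟨ht, -⟩, h4⟩ := h4
  have h3 : s • (v' - v) = ε • z := add_left_cancel h3
  have h4 : t • (v' - v) = δ • (-z) := add_left_cancel h4
  -- Both `z` and `-z` point from the end `v` into the segment, as nonnegative multiples of `v' -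
  -- v`. This forces both multiples to vanish.
  have h5 : (δ * s + ε * t) • (v' - v) = 0 := by
    rw [add_smul, mul_smul, mul_smul, h3, h4, smul_smul, smul_smul, mul_comm ε δ, smul_neg,
      add_neg_cancel]
  have h6 : δ * s + ε * t = 0 := (smul_eq_zero.1 h5).resolve_right (sub_ne_zero.2 hne.symm)
  have h7 : s = 0 := by
    have := mul_nonneg hδ.le hs
    have := mul_nonneg hε.le ht
    have : δ * s = 0 := by linarith
    exact (mul_eq_zero.1 this).resolve_left hδ.ne'
  rw [h7, zero_smul] at h3
  exact (smul_eq_zero.1 h3.symm).resolve_left hε.ne'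

theorem IsEdge.isVertex_right {v v' : V} (h : IsEdge (polyhedron p a b) v v') :
    IsVertex (polyhedron p a b) v' :=
  IsEdge.isVertex_left p h.symm

/-- The direction of an edge spans the common kernel of the constraints that are active on it. -/
theorem IsEdge.exists_eq_smul {v v' z : V} (h : IsEdge (polyhedron p a b) v v')
    (hz : ∀ i ∈ supportingFacets p a b v ∩ supportingFacets p a b v', p (a i) z = 0) :
    ∃ t : ℝ, z = t • (v' - v) := by
  have hv := (IsEdge.isVertex_left p h).mem
  have hv' := (IsEdge.isVertex_right p h).mem
  obtain ⟨hne, hf⟩ := h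
  obtain ⟨-, w, hw⟩ := (isFace_iff p).1 hf
  have hx : midpoint ℝ v v' ∈ polyhedron p a b ∧
      ∀ y ∈ polyhedron p a b, p w y ≤ p w (midpoint ℝ v v') := by
    have : midpoint ℝ v v' ∈ segment ℝ v v' := midpoint_mem_segment v v'
    rwa [hw] at this
  -- The slack at the midpoint is the mean of the slacks at the ends, so a constraint active there
  -- is active at both ends.
  have hz' : ∀ i ∈ supportingFacets p a b (midpoint ℝ v v'), p (a i) z = 0 := by
    intro i hi
    have h1 := ((mem_supportingFacets p).1 hi).2
    have h2 := hv i
    have h3 := hv' i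
    rw [midpoint_eq_smul_add, map_smul, map_add, smul_eq_mul, invOf_eq_inv] at h1
    refine hz i (Finset.mem_inter.2 ⟨(mem_supportingFacets p).2 ⟨hv, ?_⟩,
      (mem_supportingFacets p).2 ⟨hv', ?_⟩⟩) <;> linarith
  have h0 := pairing_eq_zero_of_isMax p hx.1 hx.2 hz'
  obtain ⟨ε, hε, h1⟩ := exists_pos_add_smul_mem p hx.1 fun i hi => (hz' i hi).le
  have h3 : midpoint ℝ v v' + ε • z ∈ segment ℝ v v' := by
    rw [hw]
    exact ⟨h1 ε hε.le le_rfl, fun y hy => by simpa [h0] using hx.2 y hy⟩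
  rw [segment_eq_image'] at h3
  obtain ⟨s, -, h3⟩ := h3
  refine ⟨ε⁻¹ * (s - 2⁻¹), ?_⟩
  have h4 : ε • z = (s - 2⁻¹) • (v' - v) := by
    have : ε • z = v + s • (v' - v) - midpoint ℝ v v' := by
      rw [eq_sub_iff_add_eq', ← h3]
    rw [this, midpoint_eq_smul_add, invOf_eq_inv]
    module
  rw [mul_smul, ← h4, inv_smul_smul₀ hε.ne']

end PerfectPairing

end Polyhedra

/-! ### Existence, uniqueness and meaning of wall relations. -/

section WallRelations

variable {W : Type*} [AddCommGroup W] [Module ℝ W] {m : ℕ} {a : Fin m → W}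
  {S S' : Finset (Fin m)} {k k' : Fin m} {c : Fin m → ℝ}

theorem insert_inter_eq_of_sdiff_eq (h : S \ S' = {k}) : insert k (S ∩ S') = S := by
  rw [Finset.insert_eq, ← h, Finset.sdiff_union_inter]

theorem notMem_inter_of_sdiff_eq (h : S \ S' = {k}) : k ∉ S ∩ S' := by
  intro hk
  have : k ∈ S \ S' := by rw [h]; exact Finset.mem_singleton_self k
  exact (Finset.mem_sdiff.1 this).2 (Finset.mem_inter.1 hk).2

/-- A wall relation, solved for the generator that does not belong to `S`. -/
theorem IsWallRelation.sum_eq (h : IsWallRelation a S S' k k' c) :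
    ∑ i ∈ S, (if i = k then -c i else c i) • a i = c k' • a k' := by
  have hk := notMem_inter_of_sdiff_eq h.sdiff_eq
  rw [← insert_inter_eq_of_sdiff_eq h.sdiff_eq, Finset.sum_insert hk]
  have : ∑ i ∈ S ∩ S', (if i = k then -c i else c i) • a i = ∑ i ∈ S ∩ S', c i • a i := by
    refine Finset.sum_congr rfl fun i hi => ?_
    rw [if_neg]
    rintro rfl
    exact hk hi
  rw [this, h.relation, if_pos rfl]
  module

variable {V : Type*} [NormedAddCommGroup V] [NormedSpace ℝ V] (p : W →ₗ[ℝ] V →ₗ[ℝ] ℝ)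

/-- If the `a i` with `i ∈ S` form a basis, and the hyperplanes `i ∈ S ∩ S'` meet in a line on which
the other generators of `S` and `S'` are of opposite sign, then there is a unique wall relation. -/
theorem hasUniqueWallRelation (hli : LinearIndepOn ℝ a (S : Set (Fin m)))
    (hspan : Submodule.span ℝ (a '' (S : Set (Fin m))) = ⊤)
    (h : S \ S' = {k}) (h' : S' \ S = {k'}) {e : V} (he : ∀ i ∈ S ∩ S', p (a i) e = 0)
    (hk : p (a k) e < 0) (hk' : 0 < p (a k') e) : HasUniqueWallRelation a S S' := by
  have hkI := notMem_inter_of_sdiff_eq h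
  have hkS : k ∈ S := by rw [← insert_inter_eq_of_sdiff_eq h]; exact Finset.mem_insert_self _ _
  have hkS' : k' ∈ S' := by rw [← insert_inter_eq_of_sdiff_eq h']; exact Finset.mem_insert_self _ _
  have hk'S : k' ∉ S := fun hh => notMem_inter_of_sdiff_eq h' (Finset.mem_inter.2 ⟨hkS', hh⟩)
  have hkk' : k ≠ k' := by rintro rfl; exact hk'S hkS
  have hmem : a k' ∈ Submodule.span ℝ (a '' (S : Set (Fin m))) := by rw [hspan]; trivial
  obtain ⟨l, hl⟩ := (Submodule.mem_span_image_finset_iff_exists_fun' ℝ).1 hmem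
  rw [← insert_inter_eq_of_sdiff_eq h, Finset.sum_insert hkI] at hl
  -- Pairing the expansion of `a k'` with `e` leaves only the term of `k`.
  have hlk : l k < 0 := by
    have h1 := congrArg (fun w => p w e) hl
    simp only [map_add, map_sum, map_smul, LinearMap.add_apply, LinearMap.sum_apply,
      LinearMap.smul_apply, smul_eq_mul] at h1
    rw [Finset.sum_eq_zero fun i hi => by rw [he i hi, mul_zero], add_zero] at h1
    by_contra hneg
    nlinarith
  -- Normalised to `c k' = 1`. The coefficient of `a k` changes sides, and with it sign.
  set c : Fin m → ℝ := fun i => if i = k' then 1 else if i = k then -l i else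
    if i ∈ S then l i else 0 with hc
  have hck : c k = -l k := by simp [hc, hkk']
  have hck' : c k' = 1 := by simp [hc]
  have hcI : ∀ i ∈ S ∩ S', c i = l i := by
    intro i hi
    have h1 : i ≠ k' := by rintro rfl; exact hk'S (Finset.mem_inter.1 hi).1
    have h2 : i ≠ k := by rintro rfl; exact hkI hi
    simp [hc, h1, h2, (Finset.mem_inter.1 hi).1]
  have hrel : IsWallRelation a S S' k k' c := by
    refine ⟨h, h', fun i hi => ?_, by rw [hck]; linarith, by rw [hck']; norm_num, ?_⟩
    · rw [Finset.mem_union, not_or] at hi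
      have h1 : i ≠ k' := by rintro rfl; exact hi.2 hkS'
      have h2 : i ≠ k := by rintro rfl; exact hi.1 hkS
      simp [hc, h1, h2, hi.1]
    · rw [Finset.sum_congr rfl fun i hi => by rw [hcI i hi], hck, hck', one_smul, ← hl]
      module
  refine ⟨k, k', c, hrel, fun G G' c' hc' => ?_⟩
  obtain rfl : G = k := Finset.singleton_injective (hc'.sdiff_eq.symm.trans h)
  obtain rfl : G' = k' := Finset.singleton_injective (hc'.sdiff_eq'.symm.trans h')
  -- As `c G' = 1`, the factor can only be `c' G'`. Both relations expand a multiple of `a G'` in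
  -- the basis `S`, so independence compares their coefficients.
  refine ⟨rfl, rfl, c' G', hc'.pos', ?_⟩
  have h0 : ∑ i ∈ S, ((if i = G then -c' i else c' i) - c' G' * (if i = G then -c i else c i)) • a i
      = 0 := by
    simp only [sub_smul, mul_smul, Finset.sum_sub_distrib, ← Finset.smul_sum]
    rw [hc'.sum_eq, hrel.sum_eq, hck', one_smul, sub_self]
  have h1 := linearIndepOn_finset_iff.1 hli _ h0
  ext i
  rw [Pi.smul_apply, smul_eq_mul]
  by_cases hi : i ∈ S
  · have h2 := h1 i hi
    split_ifs at h2 <;> linarith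
  · by_cases hi' : i = G'
    · rw [hi', hck', mul_one]
    · have h3 : i ∉ S ∪ S' := by
        rw [← insert_inter_eq_of_sdiff_eq h', Finset.mem_union, Finset.mem_insert,
          Finset.mem_inter]
        tauto
      rw [hc'.support i h3, hrel.support i h3, mul_zero]

/-- If `u` lies on the hyperplanes `i ∈ S`, then the wall inequality says that `u` satisfies the
other inequality. -/
theorem wallInequality_iff (hw : HasUniqueWallRelation a S S') {b : Fin m → ℝ} {u : V}
    (hu : ∀ i ∈ S, p (a i) u = b i) (h' : S' \ S = {k'}) :
    WallInequality a S S' b ↔ p (a k') u ≤ b k' := by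
  have key : ∀ F F' c, IsWallRelation a S S' F F' c →
      (∑ i ∈ S ∩ S', c i * b i ≤ c F * b F + c F' * b F' ↔ p (a k') u ≤ b k') := by
    intro F F' c hc
    obtain rfl : F' = k' := Finset.singleton_injective (hc.sdiff_eq'.symm.trans h')
    have hF : F ∈ S := by
      rw [← insert_inter_eq_of_sdiff_eq hc.sdiff_eq]; exact Finset.mem_insert_self _ _
    -- Paired with `u`, the relation is the wall inequality as an equality, except that `p (a F') u`
    -- stands in place of `b F'`.
    have h1 := congrArg (fun w => p w u) hc.relation
    simp only [map_add, map_sum, map_smul, LinearMap.add_apply, LinearMap.sum_apply,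
      LinearMap.smul_apply, smul_eq_mul] at h1
    rw [hu F hF, Finset.sum_congr rfl fun i hi => by rw [hu i (Finset.mem_inter.1 hi).1]] at h1
    rw [h1, add_le_add_iff_left, mul_le_mul_iff_right₀ hc.pos']
  -- `WallInequality` would hold vacuously without a relation, so existence is needed here.
  obtain ⟨F, F', c, hc, -⟩ := hw
  exact ⟨fun h => (key F F' c hc).1 (h F F' c hc), fun h F F' c hc => (key F F' c hc).2 h⟩

end WallRelations

/-! ### Deformation cones and facet descriptions. -/

section DeformationVectors

variable {V W : Type*} [NormedAddCommGroup V] [NormedSpace ℝ V] [AddCommGroup W] [Module ℝ W]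
  (p : W →ₗ[ℝ] V →ₗ[ℝ] ℝ) {m : ℕ} {a : Fin m → W} {b₀ : Fin m → ℝ}

theorem mem_deformationCone_iff {b : Fin m → ℝ} : b ∈ deformationCone p a b₀ ↔
    Bornology.IsBounded (polyhedron p a b) ∧ ∀ v, IsVertex (polyhedron p a b₀) v →
      ∃ u, IsVertex (polyhedron p a b) u ∧
        {x | ∀ i ∈ supportingFacets p a b₀ v, p (a i) x = b i} = {u} := by
  have hS : ∀ v i, i ∈ supportingFacets p a b₀ v ↔ v ∈ facet p a b₀ i := fun v i =>
    mem_supportingFacets p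
  simp only [hS]
  constructor
  · rintro ⟨Q, hQ, rfl, h⟩
    exact ⟨hQ.1, h⟩
  · rintro ⟨h, h'⟩
    exact ⟨_, ⟨h, m, a, b, rfl⟩, rfl, h'⟩

theorem IsFacetDescription.nonempty_facet (h : IsFacetDescription p a b₀) (j : Fin m) :
    (facet p a b₀ j).Nonempty := by
  have : facet p a b₀ j ∈ {F | IsFacet (polyhedron p a b₀) F} := by
    rw [← h.range_eq]; exact ⟨j, rfl⟩
  exact this.1.1

theorem IsFacetDescription.nonempty (h : IsFacetDescription p a b₀) :
    (polyhedron p a b₀).Nonempty := by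
  rw [← affineSpan_nonempty ℝ, h.full_dimensional]
  exact ⟨0, trivial⟩

theorem IsFacetDescription.dim_eq (h : IsFacetDescription p a b₀) :
    dim (polyhedron p a b₀) = Module.finrank ℝ V := by
  rw [dim, ← direction_affineSpan, h.full_dimensional, AffineSubspace.direction_top, finrank_top]

/-- Since the facets are indexed without repetition, counting indices at `v` is counting facets. -/
theorem IsFacetDescription.card_supportingFacets (h : IsFacetDescription p a b₀)
    (hs : IsSimple (polyhedron p a b₀)) {v : V} (hv : IsVertex (polyhedron p a b₀) v) :
    (supportingFacets p a b₀ v).card = Module.finrank ℝ V := by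
  rw [← h.dim_eq, ← hs v hv, ← Set.ncard_coe_finset, ← Set.ncard_image_of_injective _ h.injective]
  congr 1
  ext F
  constructor
  · rintro ⟨i, hi, rfl⟩
    refine ⟨?_, (mem_supportingFacets p).1 hi⟩
    have : facet p a b₀ i ∈ Set.range (facet p a b₀) := ⟨i, rfl⟩
    rwa [h.range_eq] at this
  · rintro ⟨hF, hvF⟩
    have : F ∈ Set.range (facet p a b₀) := by rw [h.range_eq]; exact hF
    obtain ⟨i, rfl⟩ := this
    exact ⟨i, (mem_supportingFacets p).2 hvF, rfl⟩

end DeformationVectors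

/-! ### Simple polytopes: edge directions, the simplex step, the wall inequalities. -/

section SimplePolytopes

variable {V W : Type*} [NormedAddCommGroup V] [NormedSpace ℝ V] [FiniteDimensional ℝ V]
  [AddCommGroup W] [Module ℝ W] (p : W →ₗ[ℝ] V →ₗ[ℝ] ℝ) [p.IsPerfPair] {m : ℕ} {a : Fin m → W}
  {b₀ : Fin m → ℝ}

theorem IsVertex.linearIndepOn {v : V} (hv : IsVertex (polyhedron p a b₀) v)
    (hc : (supportingFacets p a b₀ v).card = Module.finrank ℝ V) :
    LinearIndepOn ℝ a (supportingFacets p a b₀ v : Set (Fin m)) := by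
  refine linearIndependent_of_top_le_span_of_card_eq_finrank ?_ ?_
  · rw [← hv.span_eq_top p, Set.image_eq_range]
  · rw [finrank_eq_of_isPerfPair p, ← hc]
    simp

/-- The directions of the edges at a simple vertex. -/
theorem IsVertex.exists_dual {v : V} (hv : IsVertex (polyhedron p a b₀) v)
    (hc : (supportingFacets p a b₀ v).card = Module.finrank ℝ V) :
    ∃ e : Fin m → V, ∀ k ∈ supportingFacets p a b₀ v, ∀ i ∈ supportingFacets p a b₀ v,
      p (a i) (e k) = if i = k then -1 else 0 := by
  have hli := linearIndepOn_iff_notMem_span.1 (hv.linearIndepOn p hc)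
  have key : ∀ k, ∃ e : V, k ∈ supportingFacets p a b₀ v → ∀ i ∈ supportingFacets p a b₀ v,
      p (a i) e = if i = k then -1 else 0 := by
    intro k
    by_cases hk : k ∈ supportingFacets p a b₀ v
    · have h1 := mt (mem_span_of_forall_pairing_eq_zero p) (hli k hk)
      push Not at h1
      obtain ⟨z, hz, hz0⟩ := h1
      refine ⟨-(p (a k) z)⁻¹ • z, fun _ i hi => ?_⟩
      rw [map_smul, smul_eq_mul]
      split_ifs with hik
      · rw [hik, neg_mul, inv_mul_cancel₀ hz0]
      · rw [hz (a i) ⟨i, ⟨hi, hik⟩, rfl⟩, mul_zero]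
    · exact ⟨0, fun h => absurd h hk⟩
  choose e he using key
  exact ⟨e, he⟩

/-- The hyperplanes of the facets at a simple vertex intersect, also after parallel displacement. -/
theorem IsVertex.exists_forall_pairing_eq {v : V} (hv : IsVertex (polyhedron p a b₀) v)
    (hc : (supportingFacets p a b₀ v).card = Module.finrank ℝ V) (b : Fin m → ℝ) :
    ∃ u : V, ∀ i ∈ supportingFacets p a b₀ v, p (a i) u = b i := by
  obtain ⟨e, he⟩ := hv.exists_dual p hc
  refine ⟨∑ k ∈ supportingFacets p a b₀ v, -b k • e k, fun i hi => ?_⟩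
  rw [map_sum, Finset.sum_eq_single i]
  · rw [map_smul, he i hi i hi, if_pos rfl, smul_eq_mul]
    ring
  · intro k hk hki
    rw [map_smul, he k hk i hi, if_neg hki.symm, smul_zero]
  · exact fun h => absurd hi h

theorem IsVertex.eq_of_forall_pairing_eq {v x y : V} (hv : IsVertex (polyhedron p a b₀) v)
    (h : ∀ i ∈ supportingFacets p a b₀ v, p (a i) x = p (a i) y) : x = y :=
  sub_eq_zero.1 (((isVertex_iff p).1 hv).2 _ fun i hi => by rw [map_sub, h i hi, sub_self])

/-- If the edge left a second facet `j ≠ k`, the dual direction `e j` would be killed by all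
constraints active on the edge, hence be a multiple of `v' - v`. But `e j` is parallel to facet `k`,
which `v' - v` leaves. -/
theorem IsEdge.exists_sdiff_eq {v v' : V} (h : IsEdge (polyhedron p a b₀) v v')
    (hc : (supportingFacets p a b₀ v).card = Module.finrank ℝ V) :
    ∃ k, supportingFacets p a b₀ v \ supportingFacets p a b₀ v' = {k} ∧ p (a k) (v' - v) < 0 := by
  have hv := IsEdge.isVertex_left p h
  have hv' := IsEdge.isVertex_right p h
  have hlt : ∀ k ∈ supportingFacets p a b₀ v \ supportingFacets p a b₀ v',
      p (a k) (v' - v) < 0 := by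
    intro k hk
    rw [Finset.mem_sdiff, mem_supportingFacets, mem_supportingFacets] at hk
    rw [map_sub, sub_neg, hk.1.2]
    exact lt_of_le_of_ne (hv'.mem k) fun h => hk.2 ⟨hv'.mem, h⟩
  have hne : (supportingFacets p a b₀ v \ supportingFacets p a b₀ v').Nonempty := by
    rw [Finset.sdiff_nonempty]
    intro hsub
    refine h.1 (hv.eq_of_forall_pairing_eq p fun i hi => ?_)
    rw [((mem_supportingFacets p).1 hi).2, ((mem_supportingFacets p).1 (hsub hi)).2]
  obtain ⟨k, hk⟩ := hne
  refine ⟨k, Finset.eq_singleton_iff_unique_mem.2 ⟨hk, fun j hj => ?_⟩, hlt k hk⟩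
  by_contra hjk
  obtain ⟨e, he⟩ := hv.exists_dual p hc
  have hjS := (Finset.mem_sdiff.1 hj).1
  have hkS := (Finset.mem_sdiff.1 hk).1
  obtain ⟨t, ht⟩ := IsEdge.exists_eq_smul p h (z := e j) fun i hi => by
    rw [he j hjS i (Finset.mem_inter.1 hi).1, if_neg]
    rintro rfl
    exact (Finset.mem_sdiff.1 hj).2 (Finset.mem_inter.1 hi).2
  have h1 := he j hjS k hkS
  have h2 := he j hjS j hjS
  rw [if_neg (Ne.symm hjk), ht, map_smul, smul_eq_mul] at h1
  rw [if_pos rfl, ht, map_smul, smul_eq_mul] at h2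
  rcases mul_eq_zero.1 h1 with h3 | h3
  · rw [h3, zero_mul] at h2
    norm_num at h2
  · exact (hlt k hk).ne h3

theorem IsEdge.hasUniqueWallRelation {v v' : V} (h : IsEdge (polyhedron p a b₀) v v')
    (hc : (supportingFacets p a b₀ v).card = Module.finrank ℝ V)
    (hc' : (supportingFacets p a b₀ v').card = Module.finrank ℝ V) :
    HasUniqueWallRelation a (supportingFacets p a b₀ v) (supportingFacets p a b₀ v') := by
  have hv := IsEdge.isVertex_left p h
  obtain ⟨k, hk, hk0⟩ := IsEdge.exists_sdiff_eq p h hc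
  obtain ⟨k', hk', hk0'⟩ := IsEdge.exists_sdiff_eq p h.symm hc'
  refine DeformationCone.hasUniqueWallRelation p (hv.linearIndepOn p hc) (hv.span_eq_top p) hk hk'
    (fun i hi => ?_) hk0 ?_
  · rw [Finset.mem_inter, mem_supportingFacets, mem_supportingFacets] at hi
    rw [map_sub, hi.1.2, hi.2.2, sub_self]
  · rw [map_sub] at hk0' ⊢
    linarith

/-- The step of the simplex algorithm: at a simple vertex that does not maximize `w`, there is an
edge along which `w` increases. -/
theorem IsVertex.exists_isEdge_lt {v y : V} {w : W} (hv : IsVertex (polyhedron p a b₀) v)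
    (hbdd : Bornology.IsBounded (polyhedron p a b₀))
    (hc : (supportingFacets p a b₀ v).card = Module.finrank ℝ V)
    (hy : y ∈ polyhedron p a b₀) (hlt : p w v < p w y) :
    ∃ v', IsEdge (polyhedron p a b₀) v v' ∧ p w v < p w v' := by
  obtain ⟨e, he⟩ := hv.exists_dual p hc
  set S := supportingFacets p a b₀ v with hS
  have hSv : ∀ i ∈ S, p (a i) v = b₀ i := fun i hi => ((mem_supportingFacets p).1 hi).2
  -- The vector `y - v` is a combination of the `e k` with nonnegative coefficients, so `w`
  -- increases along one of them.
  obtain ⟨k, hk, hwk⟩ : ∃ k ∈ S, 0 < p w (e k) := by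
    by_contra! hcon
    have h1 : y - v = ∑ k ∈ S, -p (a k) (y - v) • e k := by
      refine hv.eq_of_forall_pairing_eq p fun i hi => ?_
      rw [map_sum, Finset.sum_eq_single i]
      · rw [map_smul, he i hi i hi, if_pos rfl, smul_eq_mul]
        ring
      · intro k hk hki
        rw [map_smul, he k hk i hi, if_neg hki.symm, smul_zero]
      · exact fun h => absurd hi h
    have h2 : p w (y - v) ≤ 0 := by
      rw [h1, map_sum]
      refine Finset.sum_nonpos fun k hk => ?_
      rw [map_smul, smul_eq_mul, map_sub, hSv k hk]
      nlinarith [hcon k hk, hy k]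
    rw [map_sub] at h2
    linarith
  -- `K` turns out to be the edge leaving `v` in direction `e k`. Its other end is found by
  -- minimizing `p (a k)`, which decreases along `e k`.
  set K : Set V := {x ∈ polyhedron p a b₀ | ∀ i ∈ S.erase k, p (a i) x = b₀ i} with hK
  have hvK : v ∈ K := ⟨hv.mem, fun i hi => hSv i (Finset.mem_of_mem_erase hi)⟩
  have hKc : IsCompact K := by
    refine Metric.isCompact_of_isClosed_isBounded ?_ (hbdd.subset fun x hx => hx.1)
    have : K = polyhedron p a b₀ ∩ ⋂ i ∈ S.erase k, {x | p (a i) x = b₀ i} := by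
      ext x; simp [hK]
    rw [this]
    exact (isClosed_polyhedron p a b₀).inter (isClosed_biInter fun i _ =>
      isClosed_eq (LinearMap.continuous_of_finiteDimensional _) continuous_const)
  obtain ⟨v', hv'K, hmin⟩ := hKc.exists_isMinOn ⟨v, hvK⟩
    (LinearMap.continuous_of_finiteDimensional (p (a k))).continuousOn
  have hstep : ∀ x ∈ K, ∀ ε : ℝ, 0 < ε → x + ε • e k ∈ polyhedron p a b₀ →
      p (a k) v' < p (a k) x := by
    intro x hx ε hε hmem
    have h1 : x + ε • e k ∈ K := ⟨hmem, fun i hi => by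
      rw [map_add, map_smul, he k hk i (Finset.mem_of_mem_erase hi),
        if_neg (Finset.ne_of_mem_erase hi), smul_zero, add_zero, hx.2 i hi]⟩
    have h2 : p (a k) v' ≤ p (a k) (x + ε • e k) := hmin h1
    rw [map_add, map_smul, he k hk k hk, if_pos rfl, smul_eq_mul] at h2
    linarith
  have hlt' : p (a k) v' < p (a k) v := by
    obtain ⟨ε, hε, h1⟩ := exists_pos_add_smul_mem p (z := e k) hv.mem fun i hi => by
      rw [he k hk i hi]; split_ifs <;> norm_num
    exact hstep v hvK ε hε (h1 ε hε.le le_rfl)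
  -- Unless a new constraint blocks the direction `e k` at `v'`, one could move on and contradict
  -- minimality.
  obtain ⟨k', hk', hk'e⟩ : ∃ k' ∈ supportingFacets p a b₀ v', 0 < p (a k') (e k) := by
    by_contra! hcon
    obtain ⟨ε, hε, h1⟩ := exists_pos_add_smul_mem p hv'K.1 hcon
    exact lt_irrefl _ (hstep v' hv'K ε hε (h1 ε hε.le le_rfl))
  have hpos : p (a k) (v' - v) < 0 := by rw [map_sub]; linarith
  have hker : ∀ z, (∀ i ∈ S.erase k, p (a i) z = 0) →
      z = (p (a k) z / p (a k) (v' - v)) • (v' - v) := by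
    intro z hz
    refine hv.eq_of_forall_pairing_eq p fun i hi => ?_
    by_cases hik : i = k
    · rw [hik, map_smul, smul_eq_mul, div_mul_cancel₀ _ hpos.ne]
    · have hi' := Finset.mem_erase.2 ⟨hik, hi⟩
      rw [hz i hi', map_smul, map_sub (p (a i)), hvK.2 i hi', hv'K.2 i hi', sub_self, smul_zero]
  refine ⟨v', ?_, ?_⟩
  · refine isEdge_of_forall_exists_eq_smul p (I := S.erase k) hk hk' ?_ ?_
      (Finset.erase_subset _ _) (fun i hi => ?_) fun z hz => ⟨_, hker z hz⟩
    · rw [mem_supportingFacets]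
      rintro ⟨-, h1⟩
      rw [h1, hSv k hk] at hlt'
      exact lt_irrefl _ hlt'
    · intro h1
      rw [he k hk k' h1] at hk'e
      split_ifs at hk'e <;> norm_num at hk'e
    · exact (mem_supportingFacets p).2 ⟨hv'K.1, hv'K.2 i hi⟩
  · have h1 := hker (e k) fun i hi => by
      rw [he k hk i (Finset.mem_of_mem_erase hi), if_neg (Finset.ne_of_mem_erase hi)]
    rw [he k hk k hk, if_pos rfl] at h1
    have h2 : p w (e k) = -1 / p (a k) (v' - v) * p w (v' - v) := by
      conv_lhs => rw [h1]
      rw [map_smul, smul_eq_mul]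
    rw [h2] at hwk
    have h3 := (pos_iff_pos_of_mul_pos hwk).1 (div_pos_of_neg_of_neg (by norm_num) hpos)
    rw [map_sub] at h3
    linarith

/-- The displaced vertices of a simple polytope satisfy all inequalities if they do so for the
neighbours along edges. -/
theorem pairing_le_of_forall_isEdge {b : Fin m → ℝ} {u : V → V}
    (hbdd : Bornology.IsBounded (polyhedron p a b₀))
    (hc : ∀ v, IsVertex (polyhedron p a b₀) v →
      (supportingFacets p a b₀ v).card = Module.finrank ℝ V)
    (hne : ∀ j, (facet p a b₀ j).Nonempty)
    (hu : ∀ v, IsVertex (polyhedron p a b₀) v → ∀ i ∈ supportingFacets p a b₀ v,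
      p (a i) (u v) = b i)
    (hle : ∀ v v', IsEdge (polyhedron p a b₀) v v' → ∀ i ∈ supportingFacets p a b₀ v',
      p (a i) (u v) ≤ b i)
    {v : V} (hv : IsVertex (polyhedron p a b₀) v) (j : Fin m) : p (a j) (u v) ≤ b j := by
  by_contra hcon
  obtain ⟨v, ⟨hv, hvj⟩, hmax⟩ := Set.exists_max_image
    {v | IsVertex (polyhedron p a b₀) v ∧ ¬ p (a j) (u v) ≤ b j} (fun v => p (a j) v)
    ((finite_setOf_isVertex p a b₀).subset fun v hv => hv.1) ⟨v, hv, hcon⟩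
  obtain ⟨y, hy, hyj⟩ := hne j
  have hlt : p (a j) v < p (a j) y := by
    rw [hyj]
    refine lt_of_le_of_ne (hv.mem j) fun h => hvj ?_
    exact (hu v hv j ((mem_supportingFacets p).2 ⟨hv.mem, h⟩)).le
  obtain ⟨v', he, hlt'⟩ := hv.exists_isEdge_lt p hbdd (hc v hv) hy hlt
  have hv' := IsEdge.isVertex_right p he
  have hv'j : p (a j) (u v') ≤ b j := by
    by_contra h
    exact (hmax v' ⟨hv', h⟩).not_gt hlt'
  -- Both displaced points lie on the hyperplanes shared by `v` and `v'`, so the displaced edge is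
  -- parallel to the old one.
  obtain ⟨t, ht⟩ := IsEdge.exists_eq_smul p he (z := u v' - u v) fun i hi => by
    rw [Finset.mem_inter] at hi
    rw [map_sub, hu v hv i hi.1, hu v' hv' i hi.2, sub_self]
  obtain ⟨k', hk', hk0⟩ := IsEdge.exists_sdiff_eq p he.symm (hc v' hv')
  have hk'S : k' ∈ supportingFacets p a b₀ v' := by
    rw [← insert_inter_eq_of_sdiff_eq hk']; exact Finset.mem_insert_self _ _
  have h1 := congrArg (p (a k')) ht
  have h2 := congrArg (p (a j)) ht
  have h3 := hle v v' he k' hk'S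
  rw [map_smul, map_sub, hu v' hv' k' hk'S, smul_eq_mul] at h1
  rw [map_smul, map_sub, map_sub, smul_eq_mul] at h2
  rw [map_sub] at hk0
  -- From `u v` to `u v'` the value of `a k'` rises to `b k'`, and from `v` to `v'` it rises
  -- strictly.
  have h4 : 0 ≤ t := by
    rw [map_sub] at h1
    by_contra hneg
    nlinarith
  nlinarith

/-- The deformation cone of a simple polytope is given by the wall inequalities of its edges. -/
theorem mem_deformationCone_iff_forall_wallInequality
    (hbdd : Bornology.IsBounded (polyhedron p a b₀)) (hne₀ : (polyhedron p a b₀).Nonempty)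
    (hc : ∀ v, IsVertex (polyhedron p a b₀) v →
      (supportingFacets p a b₀ v).card = Module.finrank ℝ V)
    (hne : ∀ j, (facet p a b₀ j).Nonempty) (b : Fin m → ℝ) :
    b ∈ deformationCone p a b₀ ↔ ∀ v v' : V, IsEdge (polyhedron p a b₀) v v' →
      WallInequality a (supportingFacets p a b₀ v) (supportingFacets p a b₀ v') b := by
  rw [mem_deformationCone_iff]
  constructor
  · rintro ⟨-, h⟩ v v' he
    have hv := IsEdge.isVertex_left p he
    have hv' := IsEdge.isVertex_right p he
    obtain ⟨u, hu, hu'⟩ := h v hv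
    obtain ⟨k', hk', -⟩ := IsEdge.exists_sdiff_eq p he.symm (hc v' hv')
    have hu'' : ∀ i ∈ supportingFacets p a b₀ v, p (a i) u = b i := by
      have : u ∈ ({u} : Set V) := rfl
      rwa [← hu'] at this
    rw [wallInequality_iff p (IsEdge.hasUniqueWallRelation p he (hc v hv) (hc v' hv')) hu'' hk']
    exact hu.mem k'
  · intro h
    have hex : ∀ v, ∃ u, IsVertex (polyhedron p a b₀) v → ∀ i ∈ supportingFacets p a b₀ v,
        p (a i) u = b i := by
      intro v
      by_cases hv : IsVertex (polyhedron p a b₀) v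
      · obtain ⟨u, hu⟩ := hv.exists_forall_pairing_eq p (hc v hv) b
        exact ⟨u, fun _ => hu⟩
      · exact ⟨0, fun h => absurd h hv⟩
    choose u hu using hex
    refine ⟨isBounded_polyhedron_of_isBounded p hbdd hne₀ b, fun v hv => ?_⟩
    have hmem : u v ∈ polyhedron p a b := by
      refine pairing_le_of_forall_isEdge p hbdd hc hne hu (fun v v' he i hi => ?_) hv
      have hv := IsEdge.isVertex_left p he
      have hv' := IsEdge.isVertex_right p he
      obtain ⟨k', hk', -⟩ := IsEdge.exists_sdiff_eq p he.symm (hc v' hv')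
      -- The shared facets hold with equality at `u v`; the remaining one is the wall inequality.
      rw [← insert_inter_eq_of_sdiff_eq hk', Finset.mem_insert] at hi
      rcases hi with rfl | hi
      · exact (wallInequality_iff p
          (IsEdge.hasUniqueWallRelation p he (hc v hv) (hc v' hv')) (hu v hv) hk').1 (h v v' he)
      · exact (hu v hv i (Finset.mem_inter.1 hi).2).le
    refine ⟨u v, (isVertex_iff p).2 ⟨hmem, fun z hz => ?_⟩, ?_⟩
    · refine ((isVertex_iff p).1 hv).2 z fun i hi => hz i ?_
      exact (mem_supportingFacets p).2 ⟨hmem, hu v hv i hi⟩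
    · ext x
      refine ⟨fun hx => ?_, ?_⟩
      · exact hv.eq_of_forall_pairing_eq p fun i hi => by rw [hx i hi, hu v hv i hi]
      · rintro rfl
        exact hu v hv

end SimplePolytopes

/-! ### Rays and ray generators. -/

section Rays

variable {W : Type*} [AddCommGroup W] [Module ℝ W]

theorem mem_hull_singleton {x w : W} :
    w ∈ PointedCone.hull ℝ {x} ↔ ∃ t : ℝ, 0 ≤ t ∧ w = t • x := by
  rw [PointedCone.hull, Submodule.mem_span_singleton]
  constructor
  · rintro ⟨⟨t, ht⟩, rfl⟩
    exact ⟨t, ht, rfl⟩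
  · rintro ⟨t, ht, rfl⟩
    exact ⟨⟨t, ht⟩, rfl⟩

theorem exists_pos_smul_eq_of_mem_hull {x w : W} (h : w ∈ PointedCone.hull ℝ {x}) (hw : w ≠ 0) :
    ∃ t : ℝ, 0 < t ∧ w = t • x := by
  obtain ⟨t, ht, rfl⟩ := mem_hull_singleton.1 h
  refine ⟨t, lt_of_le_of_ne ht ?_, rfl⟩
  rintro rfl
  exact hw (zero_smul ℝ x)

theorem hull_singleton_eq_of_mem {x w : W} (h : w ∈ PointedCone.hull ℝ {x}) (hw : w ≠ 0) :
    PointedCone.hull ℝ {w} = PointedCone.hull ℝ {x} := by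
  obtain ⟨t, ht, rfl⟩ := exists_pos_smul_eq_of_mem_hull h hw
  refine le_antisymm (Submodule.span_le.2 (Set.singleton_subset_iff.2 h))
    (Submodule.span_le.2 (Set.singleton_subset_iff.2 ?_))
  exact mem_hull_singleton.2 ⟨t⁻¹, by positivity, by rw [inv_smul_smul₀ ht.ne']⟩

theorem self_mem_hull_singleton (x : W) : x ∈ PointedCone.hull ℝ {x} :=
  PointedCone.subset_hull rfl

theorem finrank_span_hull_singleton {x : W} :
    Module.finrank ℝ (Submodule.span ℝ (PointedCone.hull ℝ {x} : Set W)) = 1 ↔ x ≠ 0 := by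
  rw [PointedCone.hull, Submodule.span_span_of_tower]
  constructor
  · rintro h rfl
    rw [Submodule.span_zero_singleton, finrank_bot] at h
    exact zero_ne_one h
  · exact finrank_span_singleton

variable {m : ℕ} {a : Fin m → W} {fan : Set (PointedCone ℝ W)}

theorem AreRayGenerators.hull_mem (h : AreRayGenerators fan a) (i : Fin m) :
    PointedCone.hull ℝ {a i} ∈ fan := by
  have : PointedCone.hull ℝ {a i} ∈ Set.range fun i => PointedCone.hull ℝ {a i} := ⟨i, rfl⟩
  rw [h.range_eq] at this
  exact this.1

theorem AreRayGenerators.ne_zero (h : AreRayGenerators fan a) (i : Fin m) : a i ≠ 0 := by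
  have : PointedCone.hull ℝ {a i} ∈ Set.range fun i => PointedCone.hull ℝ {a i} := ⟨i, rfl⟩
  rw [h.range_eq] at this
  exact finrank_span_hull_singleton.1 this.2

end Rays

/-! ### Normal fans and their dictionary with vertices and edges. -/

section NormalCones

variable {V W : Type*} [NormedAddCommGroup V] [NormedSpace ℝ V] [AddCommGroup W] [Module ℝ W]
  (p : W →ₗ[ℝ] V →ₗ[ℝ] ℝ) {m : ℕ} {a : Fin m → W} {b b₀ : Fin m → ℝ}

theorem mem_normalCone {F P : Set V} {w : W} :
    w ∈ normalCone p F P ↔ ∀ x ∈ F, ∀ y ∈ P, p w y ≤ p w x := Iff.rfl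

theorem mem_spanningRays {σ : PointedCone ℝ W} {i : Fin m} : i ∈ spanningRays a σ ↔ a i ∈ σ := by
  classical
  rw [spanningRays, Finset.mem_filter_univ]

/-- If a ray is a normal cone of `P`, then it is the normal cone of the face of the maximizers of its
generator. -/
theorem normalCone_setOf_isMax {P : Set V} {w : W} (h : PointedCone.hull ℝ {w} ∈ normalFan p P) :
    normalCone p {x ∈ P | ∀ y ∈ P, p w y ≤ p w x} P = PointedCone.hull ℝ {w} := by
  obtain ⟨F, hF, hw⟩ := h
  have hwF : w ∈ normalCone p F P := by rw [← hw]; exact self_mem_hull_singleton w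
  apply le_antisymm
  · intro u hu
    rw [hw]
    obtain ⟨l, hl⟩ := hF.2 hF.1
    -- `F` lies in the face of maximizers of `w`, and normal cones reverse inclusions.
    exact fun x hx y hy => hu x ⟨by rw [hl] at hx; exact hx.1, fun y hy => hwF x hx y hy⟩ y hy
  · refine Submodule.span_le.2 (Set.singleton_subset_iff.2 ?_)
    exact fun x hx y hy => hx.2 y hy

/-- Rays of the normal fan are extreme rays of the normal cones that contain them. -/
theorem mem_hull_of_add_eq {P : Set V} {v : V} {w u u' : W}
    (h : PointedCone.hull ℝ {w} ∈ normalFan p P) (hv : v ∈ P) (hu : u ∈ normalCone p {v} P)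
    (hu' : u' ∈ normalCone p {v} P) (hw : u + u' = w) : u ∈ PointedCone.hull ℝ {w} := by
  rw [← normalCone_setOf_isMax p h]
  rintro x ⟨hx, hxmax⟩ y hy
  -- `u` and `u'` are both maximal at `v`, so a maximizer `x` of their sum maximizes each.
  have h1 := hxmax v hv
  rw [← hw, map_add, LinearMap.add_apply, LinearMap.add_apply] at h1
  linarith [hu v rfl y hy, hu' v rfl x hx]

/-- Nonemptiness makes `b₀ i` the attained maximum of `a i`. -/
theorem facet_eq_setOf_isMax {i : Fin m} (h : (facet p a b₀ i).Nonempty) :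
    facet p a b₀ i =
      {x ∈ polyhedron p a b₀ | ∀ y ∈ polyhedron p a b₀, p (a i) y ≤ p (a i) x} := by
  obtain ⟨z, hz, hzi⟩ := h
  ext x
  constructor
  · rintro ⟨hx, hxi⟩
    exact ⟨hx, fun y hy => by rw [hxi]; exact hy i⟩
  · rintro ⟨hx, hxi⟩
    exact ⟨hx, le_antisymm (hx i) (by rw [← hzi]; exact hxi z hz)⟩

theorem spanningRays_normalCone {v : V} (hne : ∀ j, (facet p a b₀ j).Nonempty)
    (hv : v ∈ polyhedron p a b₀) :
    spanningRays a (normalCone p {v} (polyhedron p a b₀)) = supportingFacets p a b₀ v := by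
  ext i
  have h := facet_eq_setOf_isMax p (hne i)
  have h1 : i ∈ supportingFacets p a b₀ v ↔ v ∈ facet p a b₀ i := mem_supportingFacets p
  rw [mem_spanningRays, h1, h, mem_normalCone]
  simp [hv]

theorem normalCone_anti {F F' P : Set V} (h : F ⊆ F') : normalCone p F' P ≤ normalCone p F P :=
  fun _ hw x hx => hw x (h hx)

section PerfectPairing

variable [FiniteDimensional ℝ V] [p.IsPerfPair]

/-- Each face of a polytope contains a vertex. -/
theorem IsFace.exists_isVertex {F : Set V} (hF : IsFace (polyhedron p a b) F)
    (hbdd : Bornology.IsBounded (polyhedron p a b)) :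
    ∃ v ∈ F, IsVertex (polyhedron p a b) v := by
  have hP : IsCompact (polyhedron p a b) :=
    Metric.isCompact_of_isClosed_isBounded (isClosed_polyhedron p a b) hbdd
  -- An extreme point of the compact face is extreme in the polytope, so it is not the midpoint of a
  -- segment along a common kernel direction.
  obtain ⟨v, hv⟩ := (hF.2.isCompact hP).extremePoints_nonempty hF.1
  have hv' := hF.2.isExtreme.extremePoints_subset_extremePoints hv
  refine ⟨v, hv.1, (isVertex_iff p).2 ⟨hv'.1, fun z hz => ?_⟩⟩
  obtain ⟨ε, hε, h1⟩ := exists_pos_add_smul_mem p hv'.1 fun i hi => (hz i hi).le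
  obtain ⟨δ, hδ, h2⟩ := exists_pos_add_smul_mem p (z := -z) hv'.1 fun i hi => by simp [hz i hi]
  have h3 := h1 (min ε δ) (by positivity) (min_le_left _ _)
  have h4 := h2 (min ε δ) (by positivity) (min_le_right _ _)
  have h5 : v ∈ openSegment ℝ (v + min ε δ • z) (v + min ε δ • -z) :=
    ⟨1 / 2, 1 / 2, by norm_num, by norm_num, by norm_num, by module⟩
  have h6 := hv'.2 h3 h4 h5
  have h7 : min ε δ • z = 0 := by simpa using h6
  exact (smul_eq_zero.1 h7).resolve_left (lt_min hε hδ).ne'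

/-- The maximal cones of the normal fan are the normal cones at the vertices. -/
theorem maximal_mem_normalFan_iff (hbdd : Bornology.IsBounded (polyhedron p a b))
    {σ : PointedCone ℝ W} :
    Maximal (· ∈ normalFan p (polyhedron p a b)) σ ↔
      ∃ v, IsVertex (polyhedron p a b) v ∧ σ = normalCone p {v} (polyhedron p a b) := by
  constructor
  · rintro ⟨⟨F, hF, rfl⟩, hmax⟩
    obtain ⟨v, hvF, hv⟩ := IsFace.exists_isVertex p hF hbdd
    have h := normalCone_anti p (P := polyhedron p a b) (Set.singleton_subset_iff.2 hvF)
    exact ⟨v, hv, le_antisymm h (hmax ⟨{v}, hv, rfl⟩ h)⟩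
  · rintro ⟨v, hv, rfl⟩
    refine ⟨⟨{v}, hv, rfl⟩, ?_⟩
    rintro _ ⟨F, hF, rfl⟩ hle
    obtain ⟨-, w, hw⟩ := (isFace_iff p).1 hv
    have hwv : w ∈ normalCone p {v} (polyhedron p a b) := by
      have : v ∈ ({v} : Set V) := rfl
      rw [hw] at this
      rintro x rfl
      exact this.2
    -- The functional `w` exposes `v` alone and belongs to the larger cone, so it is maximal on all
    -- of `F`.
    have hFv : F ⊆ {v} := by
      intro x hx
      rw [hw]
      obtain ⟨l, hl⟩ := hF.2 hF.1
      exact ⟨by rw [hl] at hx; exact hx.1, hle hwv x hx⟩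
    rw [(Set.Nonempty.subset_singleton_iff hF.1).1 hFv]

/-- The deformation cone of a polytope depends on its normal fan only. -/
theorem mem_deformationCone_iff_forall_maximal (h : IsFacetDescription p a b₀) :
    b ∈ deformationCone p a b₀ ↔ Bornology.IsBounded (polyhedron p a b) ∧
      ∀ σ, Maximal (· ∈ normalFan p (polyhedron p a b₀)) σ →
        ∃ u, IsVertex (polyhedron p a b) u ∧
          {x | ∀ i ∈ spanningRays a σ, p (a i) x = b i} = {u} := by
  rw [mem_deformationCone_iff]
  refine and_congr_right fun _ => ?_
  constructor
  · intro hd σ hσ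
    obtain ⟨v, hv, rfl⟩ := (maximal_mem_normalFan_iff p h.bounded).1 hσ
    rw [spanningRays_normalCone p (h.nonempty_facet p) hv.mem]
    exact hd v hv
  · intro hd v hv
    rw [← spanningRays_normalCone p (h.nonempty_facet p) hv.mem]
    exact hd _ ((maximal_mem_normalFan_iff p h.bounded).2 ⟨v, hv, rfl⟩)

/-- A polytope with simplicial normal fan is simple. -/
theorem IsFacetDescription.card_supportingFacets_of_isSimplicialFan
    (h : IsFacetDescription p a b₀) (hs : IsSimplicialFan (normalFan p (polyhedron p a b₀)))
    (ha : AreRayGenerators (normalFan p (polyhedron p a b₀)) a) {v : V}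
    (hv : IsVertex (polyhedron p a b₀) v) :
    (supportingFacets p a b₀ v).card = Module.finrank ℝ V := by
  refine le_antisymm ?_ (hv.finrank_le_card p)
  obtain ⟨s, hfin, hli, hspan⟩ := hs _ ⟨{v}, hv, rfl⟩
  lift s to Finset W using hfin
  -- The ray of `a i` is extreme in the normal cone, so it contains one of the independent
  -- generators in `s`. Distinct rays use distinct generators, which bounds the number of facets at
  -- `v`.
  have key : ∀ i, ∃ w, i ∈ supportingFacets p a b₀ v →
      w ∈ s ∧ w ∈ PointedCone.hull ℝ {a i} := by
    intro i
    by_cases hi : i ∈ supportingFacets p a b₀ v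
    · rw [← spanningRays_normalCone p (h.nonempty_facet p) hv.mem, mem_spanningRays,
        ← hspan, PointedCone.hull, Submodule.mem_span_finset] at hi
      obtain ⟨c, -, hc⟩ := hi
      obtain ⟨w, hw, hcw⟩ : ∃ w ∈ s, c w ≠ 0 := by
        by_contra! hcon
        refine ha.ne_zero i ?_
        rw [← hc]
        exact Finset.sum_eq_zero fun w hw => by rw [hcon w hw, zero_smul]
      classical
      have hmem : ∀ u ∈ s, c u • u ∈ normalCone p {v} (polyhedron p a b₀) := by
        intro u hu
        rw [← hspan]
        exact Submodule.smul_mem _ _ (PointedCone.subset_hull hu)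
      have h1 := mem_hull_of_add_eq p (ha.hull_mem i) hv.mem (hmem w hw)
        (Submodule.sum_mem _ fun u hu => hmem u (Finset.mem_of_mem_erase hu))
        ((Finset.add_sum_erase s (fun u => c u • u) hw).trans hc)
      refine ⟨w, fun _ => ⟨hw, ?_⟩⟩
      have h2 := Submodule.smul_mem _ (c w)⁻¹ h1
      rwa [inv_smul_smul₀ hcw] at h2
    · exact ⟨0, fun h => absurd h hi⟩
  choose f hf using key
  have hcard : (supportingFacets p a b₀ v).card ≤ s.card := by
    refine Finset.card_le_card_of_injOn f (fun i hi => (hf i hi).1) fun i hi j hj hij => ?_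
    have hne : f i ≠ 0 := by
      have := hli.ne_zero (hf i hi).1
      exact this
    refine ha.injective ?_
    change PointedCone.hull ℝ {a i} = PointedCone.hull ℝ {a j}
    rw [← hull_singleton_eq_of_mem (hf i hi).2 hne, hij,
      hull_singleton_eq_of_mem (hf j hj).2 (hij ▸ hne)]
  have := finiteDimensional_of_isPerfPair p
  rw [← finrank_eq_of_isPerfPair p]
  refine hcard.trans ?_
  have h3 := LinearIndependent.fintype_card_le_finrank (R := ℝ) hli
  simpa using h3

/-- Two simple vertices whose sets of facets differ in one element are joined by an edge. -/
theorem isEdge_of_card_sdiff {v v' : V} (hv : IsVertex (polyhedron p a b₀) v)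
    (hv' : IsVertex (polyhedron p a b₀) v')
    (h : (supportingFacets p a b₀ v \ supportingFacets p a b₀ v').card = 1)
    (h' : (supportingFacets p a b₀ v' \ supportingFacets p a b₀ v).card = 1) :
    IsEdge (polyhedron p a b₀) v v' := by
  obtain ⟨k, hk⟩ := Finset.card_eq_one.1 h
  obtain ⟨k', hk'⟩ := Finset.card_eq_one.1 h'
  have h1 : k ∈ supportingFacets p a b₀ v \ supportingFacets p a b₀ v' := by
    rw [hk]; exact Finset.mem_singleton_self k
  have h2 : k' ∈ supportingFacets p a b₀ v' \ supportingFacets p a b₀ v := by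
    rw [hk']; exact Finset.mem_singleton_self k'
  rw [Finset.mem_sdiff] at h1 h2
  have hne : p (a k) (v' - v) ≠ 0 := by
    intro h0
    rw [map_sub, sub_eq_zero, ((mem_supportingFacets p).1 h1.1).2] at h0
    exact h1.2 ((mem_supportingFacets p).2 ⟨hv'.mem, h0⟩)
  refine isEdge_of_forall_exists_eq_smul p h1.1 h2.1 h1.2 h2.2 Finset.inter_subset_left
    Finset.inter_subset_right fun z hz => ⟨p (a k) z / p (a k) (v' - v), ?_⟩
  refine hv.eq_of_forall_pairing_eq p fun i hi => ?_
  rw [← insert_inter_eq_of_sdiff_eq hk, Finset.mem_insert] at hi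
  rcases hi with rfl | hi
  · rw [map_smul, smul_eq_mul, div_mul_cancel₀ _ hne]
  · have h3 := Finset.mem_inter.1 hi
    rw [hz i hi, map_smul, map_sub (p (a i)), ((mem_supportingFacets p).1 h3.1).2,
      ((mem_supportingFacets p).1 h3.2).2, sub_self, smul_zero]

/-! ### Dimension duality and the polytope behind a projective fan. -/

/-- The dimensions of a face and of its normal cone are complementary. -/
theorem IsFace.finrank_span_normalCone_add_dim {F : Set V} (hF : IsFace (polyhedron p a b) F) :
    Module.finrank ℝ (Submodule.span ℝ (normalCone p F (polyhedron p a b) : Set W)) + dim F =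
      Module.finrank ℝ V := by
  obtain ⟨hne, w₀, hw₀⟩ := (isFace_iff p).1 hF
  have hsub : F ⊆ polyhedron p a b := by rw [hw₀]; exact fun x hx => hx.1
  -- A point of `F` with fewest active constraints plays the role of a relative interior point:
  -- comparison with midpoints shows that its active constraints are active on all of `F`.
  obtain ⟨x, hx, hmin⟩ := exists_minimalFor_of_wellFoundedLT (· ∈ F)
    (fun x => (supportingFacets p a b x).card) hne
  have hconv : Convex ℝ F := hF.2.convex (convex_polyhedron p a b)
  have hactive : ∀ y ∈ F, supportingFacets p a b x ⊆ supportingFacets p a b y := by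
    intro y hy
    have hmid := hconv.midpoint_mem hx hy
    have h1 : supportingFacets p a b (midpoint ℝ x y) ⊆
        supportingFacets p a b x ∩ supportingFacets p a b y := by
      intro i hi
      have h2 := ((mem_supportingFacets p).1 hi).2
      have h3 := hsub hx i
      have h4 := hsub hy i
      rw [midpoint_eq_smul_add, map_smul, map_add, smul_eq_mul, invOf_eq_inv] at h2
      refine Finset.mem_inter.2 ⟨(mem_supportingFacets p).2 ⟨hsub hx, ?_⟩,
        (mem_supportingFacets p).2 ⟨hsub hy, ?_⟩⟩ <;> linarith
    have h2 : (supportingFacets p a b x).card ≤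
        (supportingFacets p a b (midpoint ℝ x y)).card := by
      rcases le_total (supportingFacets p a b x).card
        (supportingFacets p a b (midpoint ℝ x y)).card with h | h
      · exact h
      · exact hmin hmid h
    rw [← Finset.inter_eq_left]
    exact Finset.eq_of_subset_of_card_le Finset.inter_subset_left
      (h2.trans (Finset.card_le_card h1))
  have hx' : x ∈ polyhedron p a b ∧ ∀ y ∈ polyhedron p a b, p w₀ y ≤ p w₀ x := by
    rwa [hw₀] at hx
  have hdir : ∀ z, (∀ i ∈ supportingFacets p a b x, p (a i) z = 0) → z ∈ vectorSpan ℝ F := by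
    intro z hz
    obtain ⟨ε, hε, h1⟩ := exists_pos_add_smul_mem p hx'.1 fun i hi => (hz i hi).le
    have h0 := pairing_eq_zero_of_isMax p hx'.1 hx'.2 hz
    have h2 : x + ε • z ∈ F := by
      rw [hw₀]
      exact ⟨h1 ε hε.le le_rfl, fun y hy => by simpa [h0] using hx'.2 y hy⟩
    have h3 := vsub_mem_vectorSpan ℝ h2 hx
    rw [vsub_eq_sub, add_sub_cancel_left] at h3
    simpa [hε.ne'] using Submodule.smul_mem _ ε⁻¹ h3
  have hmap : (Submodule.span ℝ (normalCone p F (polyhedron p a b) : Set W)).map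
      (LinearEquiv.ofBijective p (LinearMap.IsPerfPair.bijective_left p) :
        W →ₗ[ℝ] Module.Dual ℝ V) = (vectorSpan ℝ F).dualAnnihilator := by
    apply le_antisymm
    · rw [Submodule.map_le_iff_le_comap, Submodule.span_le]
      intro w hw
      change p w ∈ (vectorSpan ℝ F).dualAnnihilator
      rw [Submodule.mem_dualAnnihilator]
      have h1 : vectorSpan ℝ F ≤ LinearMap.ker (p w) := by
        refine Submodule.span_le.2 ?_
        rintro _ ⟨y, hy, y', hy', rfl⟩
        change p w (y - y') = 0
        rw [map_sub, sub_eq_zero]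
        exact le_antisymm (hw y' hy' y (hsub hy)) (hw y hy y' (hsub hy'))
      exact fun z hz => h1 hz
    · intro φ hφ
      obtain ⟨w, rfl⟩ := (LinearMap.IsPerfPair.bijective_left p).2 φ
      rw [Submodule.mem_dualAnnihilator] at hφ
      refine ⟨w, ?_, rfl⟩
      have h1 : w ∈ Submodule.span ℝ (a '' (supportingFacets p a b x : Set (Fin m))) :=
        mem_span_of_forall_pairing_eq_zero p fun z hz =>
          hφ z (hdir z fun i hi => hz _ ⟨i, hi, rfl⟩)
      refine Submodule.span_mono ?_ h1
      rintro _ ⟨i, hi, rfl⟩ y hy y' hy'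
      rw [((mem_supportingFacets p).1 (hactive y hy hi)).2]
      exact hy' i
  rw [← LinearEquiv.finrank_map_eq
    (LinearEquiv.ofBijective p (LinearMap.IsPerfPair.bijective_left p)), dim]
  erw [hmap]
  rw [add_comm]
  exact Subspace.finrank_add_finrank_dualAnnihilator_eq _

/-- A full-dimensional polyhedron has a representation in which each inequality defines a ray of the
normal fan. -/
theorem exists_eq_polyhedron_forall_hull_mem {P : Set V} {k : ℕ} {a' : Fin k → W} {b' : Fin k → ℝ}
    (hP : P = polyhedron p a' b') (hint : (interior P).Nonempty) :
    ∃ (n : ℕ) (a : Fin n → W) (b : Fin n → ℝ), P = polyhedron p a b ∧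
      ∀ i, a i ≠ 0 ∧ PointedCone.hull ℝ {a i} ∈ normalFan p P := by
  classical
  -- A description with the fewest inequalities has no redundant one.
  have hex : ∃ n, ∃ (a : Fin n → W) (b : Fin n → ℝ), P = polyhedron p a b := ⟨k, a', b', hP⟩
  obtain ⟨a, b, hab⟩ := Nat.find_spec hex
  have hmin := fun n => Nat.find_min hex (m := n)
  generalize Nat.find hex = n at a b hab hmin
  refine ⟨n, a, b, hab, fun i => ?_⟩
  obtain ⟨n, rfl⟩ : ∃ l, n = l + 1 := Nat.exists_eq_succ_of_ne_zero fun h => by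
    subst h; exact i.elim0
  have hirr : ∀ i, ∃ x, (∀ j, j ≠ i → p (a j) x ≤ b j) ∧ b i < p (a i) x := by
    intro i
    by_contra! hcon
    refine hmin n (Nat.lt_succ_self n) ⟨a ∘ i.succAbove, b ∘ i.succAbove, ?_⟩
    rw [hab]
    apply Set.Subset.antisymm
    · exact fun x hx j => hx _
    · intro x hx
      have h1 : ∀ j, j ≠ i → p (a j) x ≤ b j := by
        intro j hj
        obtain ⟨l, rfl⟩ := Fin.exists_succAbove_eq hj
        exact hx l
      intro j
      by_cases hj : j = i
      · rw [hj]; exact hcon x h1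
      · exact h1 j hj
  obtain ⟨y, hy⟩ := hint
  have hyP : y ∈ polyhedron p a b := hab ▸ interior_subset hy
  have hne : ∀ j, a j ≠ 0 := by
    intro j hj
    obtain ⟨x, -, hx⟩ := hirr j
    have := hyP j
    rw [hj, map_zero, LinearMap.zero_apply] at hx this
    linarith
  have hstrict : ∀ j, p (a j) y < b j := by
    intro j
    obtain ⟨z, hz⟩ : ∃ z, p (a j) z ≠ 0 := by
      by_contra! hcon
      refine hne j ((LinearMap.IsPerfPair.bijective_left p).1 ?_)
      ext z
      rw [hcon z, map_zero, LinearMap.zero_apply]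
    -- Along `p (a j) z • z` the value of `a j` grows by a square, so equality at the interior point
    -- `y` is impossible.
    have hcont : Continuous fun t : ℝ => y + t • (p (a j) z • z) := by fun_prop
    have h1 : ∀ᶠ t : ℝ in nhdsWithin 0 (Set.Ioi 0), y + t • (p (a j) z • z) ∈ interior P := by
      refine (hcont.tendsto 0).eventually ?_ |>.filter_mono nhdsWithin_le_nhds
      simpa using isOpen_interior.mem_nhds hy
    obtain ⟨t, ht, ht0⟩ := (h1.and self_mem_nhdsWithin).exists
    have ht0 : 0 < t := ht0
    have h2 := (hab ▸ interior_subset ht : y + t • (p (a j) z • z) ∈ polyhedron p a b) j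
    rw [map_add, map_smul, map_smul, smul_eq_mul, smul_eq_mul] at h2
    have : 0 < t * (p (a j) z * p (a j) z) := mul_pos ht0 (mul_self_pos.2 hz)
    linarith
  obtain ⟨x, hxj, hxi⟩ := hirr i
  have hden : 0 < p (a i) x - p (a i) y := by linarith [hyP i]
  -- The point `z` where the segment from `y` to `x` crosses hyperplane `i`. There `i` is the only
  -- active constraint, so each functional maximal at `z` is a multiple of `a i`.
  set s := (b i - p (a i) y) / (p (a i) x - p (a i) y) with hs
  have hs0 : 0 < s := div_pos (by linarith [hstrict i]) hden
  have hs1 : s < 1 := (div_lt_one hden).2 (by linarith)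
  have hsmul : s * (p (a i) x - p (a i) y) = b i - p (a i) y := div_mul_cancel₀ _ hden.ne'
  set z := y + s • (x - y) with hz
  have hpz : ∀ j, p (a j) z = p (a j) y + s * (p (a j) x - p (a j) y) := fun j => by
    rw [hz, map_add, map_smul, map_sub, smul_eq_mul]
  have hzi : p (a i) z = b i := by rw [hpz, hsmul]; ring
  have hzj : ∀ j, j ≠ i → p (a j) z < b j := by
    intro j hj
    rw [hpz]
    have h1 : s * p (a j) x ≤ s * b j := mul_le_mul_of_nonneg_left (hxj j hj) hs0.le
    have h2 : (1 - s) * p (a j) y < (1 - s) * b j :=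
      mul_lt_mul_of_pos_left (hstrict j) (by linarith)
    linarith
  have hzP : z ∈ polyhedron p a b := by
    intro j
    by_cases hj : j = i
    · rw [hj, hzi]
    · exact (hzj j hj).le
  have hzS : ∀ j ∈ supportingFacets p a b z, j = i := by
    intro j hj
    by_contra hji
    exact (hzj j hji).ne ((mem_supportingFacets p).1 hj).2
  have hzmax : ∀ y ∈ polyhedron p a b, p (a i) y ≤ p (a i) z := fun y hy => by
    rw [hzi]; exact hy i
  refine ⟨hne i, {x ∈ polyhedron p a b | ∀ y ∈ polyhedron p a b, p (a i) y ≤ p (a i) x}, ?_, ?_⟩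
  · rw [hab]
    exact (isFace_iff p).2 ⟨⟨z, hzP, hzmax⟩, a i, rfl⟩
  · rw [hab]
    apply le_antisymm
    · refine Submodule.span_le.2 (Set.singleton_subset_iff.2 ?_)
      exact fun x hx y hy => hx.2 y hy
    · intro w hw
      have hwz : ∀ y ∈ polyhedron p a b, p w y ≤ p w z := hw z ⟨hzP, hzmax⟩
      have h1 : w ∈ Submodule.span ℝ {a i} := by
        refine mem_span_of_forall_pairing_eq_zero p fun q hq => ?_
        refine pairing_eq_zero_of_isMax p hzP hwz fun j hj => ?_
        rw [hzS j hj]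
        exact hq _ rfl
      obtain ⟨t, rfl⟩ := Submodule.mem_span_singleton.1 h1
      refine mem_hull_singleton.2 ⟨t, ?_, rfl⟩
      have h2 := hwz y hyP
      rw [map_smul, LinearMap.smul_apply, LinearMap.smul_apply, smul_eq_mul, smul_eq_mul,
        hzi] at h2
      have h3 := hstrict i
      by_contra hneg
      nlinarith

/-- A polytope whose normal fan contains the zero cone is described by the ray generators of its
normal fan. -/
theorem exists_isFacetDescription {P : Set V} (hne : P.Nonempty) (hP : IsPolytope p P)
    (hbot : ⊥ ∈ normalFan p P) (ha : AreRayGenerators (normalFan p P) a) :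
    ∃ b₀, P = polyhedron p a b₀ ∧ IsFacetDescription p a b₀ := by
  obtain ⟨hbdd, k, a', b', hP'⟩ := hP
  -- A face with normal cone `⊥` has full dimension by duality.
  have hfull : affineSpan ℝ P = ⊤ := by
    rw [AffineSubspace.affineSpan_eq_top_iff_vectorSpan_eq_top_of_nonempty ℝ V V hne]
    obtain ⟨F, hF, hbotF⟩ := hbot
    have hFP : F ⊆ P := by
      obtain ⟨l, hl⟩ := hF.2 hF.1
      rw [hl]
      exact fun x hx => hx.1
    have h1 := IsFace.finrank_span_normalCone_add_dim p (hP' ▸ hF)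
    rw [← hP', ← hbotF] at h1
    have h2 : Module.finrank ℝ (vectorSpan ℝ F) = Module.finrank ℝ V := by
      have h3 : Submodule.span ℝ ((⊥ : PointedCone ℝ W) : Set W) = ⊥ := by
        rw [Submodule.bot_coe]
        exact Submodule.span_zero_singleton ℝ
      rwa [h3, finrank_bot, zero_add] at h1
    rw [eq_top_iff, ← Submodule.eq_top_of_finrank_eq h2]
    exact vectorSpan_mono ℝ hFP
  have hconv : Convex ℝ P := hP' ▸ convex_polyhedron p a' b'
  obtain ⟨n, c, d, hcd, hc⟩ := exists_eq_polyhedron_forall_hull_mem p hP'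
    (hconv.interior_nonempty_iff_affineSpan_eq_top.2 hfull)
  -- The right-hand sides are the maxima of the `a j` on `P`. Each irredundant normal `c i` spans a
  -- ray of the fan, so its inequality follows from that of some `a j`.
  have hmax : ∀ j, ∃ x ∈ P, ∀ y ∈ P, p (a j) y ≤ p (a j) x := by
    intro j
    obtain ⟨F, hF, hj⟩ := ha.hull_mem j
    have h1 : a j ∈ normalCone p F P := by rw [← hj]; exact self_mem_hull_singleton _
    obtain ⟨x, hx⟩ := hF.1
    obtain ⟨l, hl⟩ := hF.2 hF.1
    exact ⟨x, by rw [hl] at hx; exact hx.1, h1 x hx⟩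
  choose x hxP hx using hmax
  have hPeq : P = polyhedron p a fun j => p (a j) (x j) := by
    apply Set.Subset.antisymm
    · exact fun y hy j => hx j y hy
    · intro y hy
      rw [hcd]
      intro i
      have h1 : PointedCone.hull ℝ {c i} ∈ Set.range fun i => PointedCone.hull ℝ {a i} := by
        rw [ha.range_eq]
        exact ⟨(hc i).2, finrank_span_hull_singleton.2 (hc i).1⟩
      obtain ⟨j, hj⟩ := h1
      have h2 : c i ∈ PointedCone.hull ℝ {a j} := by
        have hj : PointedCone.hull ℝ {a j} = PointedCone.hull ℝ {c i} := hj
        rw [hj]; exact self_mem_hull_singleton _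
      obtain ⟨t, ht, hct⟩ := mem_hull_singleton.1 h2
      have h3 : p (c i) (x j) ≤ d i := (hcd ▸ hxP j : x j ∈ polyhedron p c d) i
      rw [hct, map_smul, LinearMap.smul_apply, smul_eq_mul] at h3 ⊢
      exact (mul_le_mul_of_nonneg_left (hy j) ht).trans h3
  refine ⟨_, hPeq, ?_⟩
  generalize hb₀ : (fun j => p (a j) (x j)) = b₀ at hPeq
  have hnf : ∀ j, (facet p a b₀ j).Nonempty := fun j => ⟨x j, hPeq ▸ hxP j, by rw [← hb₀]⟩
  subst hPeq
  have hcone : ∀ j, normalCone p (facet p a b₀ j) (polyhedron p a b₀) =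
      PointedCone.hull ℝ {a j} := fun j => by
    rw [facet_eq_setOf_isMax p (hnf j), normalCone_setOf_isMax p (ha.hull_mem j)]
  have hdim : dim (polyhedron p a b₀) = Module.finrank ℝ V := by
    rw [dim, ← direction_affineSpan, hfull, AffineSubspace.direction_top, finrank_top]
  refine ⟨hbdd, hfull, fun i j hij => ha.injective ?_, ?_⟩
  · change PointedCone.hull ℝ {a i} = PointedCone.hull ℝ {a j}
    rw [← hcone i, ← hcone j]
    exact congrArg (fun F => normalCone p F (polyhedron p a b₀)) hij
  · ext F
    constructor
    · rintro ⟨i, rfl⟩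
      have hface : IsFace (polyhedron p a b₀) (facet p a b₀ i) :=
        (isFace_iff p).2 ⟨hnf i, a i, facet_eq_setOf_isMax p (hnf i)⟩
      refine ⟨hface, ?_⟩
      have h1 := IsFace.finrank_span_normalCone_add_dim p hface
      rw [hcone i, finrank_span_hull_singleton.2 (ha.ne_zero i)] at h1
      omega
    -- By duality the normal cone of a facet is a ray, hence generated by some `a i`; a face is
    -- recovered from its normal cone.
    · rintro ⟨hF, hFdim⟩
      have h1 := IsFace.finrank_span_normalCone_add_dim p hF
      have h2 : normalCone p F (polyhedron p a b₀) ∈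
          Set.range fun i => PointedCone.hull ℝ {a i} := by
        rw [ha.range_eq]
        exact ⟨⟨F, hF, rfl⟩, by omega⟩
      obtain ⟨i, hi⟩ := h2
      have hi : PointedCone.hull ℝ {a i} = normalCone p F (polyhedron p a b₀) := hi
      refine ⟨i, ?_⟩
      obtain ⟨-, w, hw⟩ := (isFace_iff p).1 hF
      have hwF : w ∈ normalCone p F (polyhedron p a b₀) := by
        intro y hy
        rw [hw] at hy
        exact hy.2
      have hai : a i ∈ normalCone p F (polyhedron p a b₀) := by
        rw [← hi]; exact self_mem_hull_singleton _
      rw [facet_eq_setOf_isMax p (hnf i)]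
      apply Set.Subset.antisymm
      · rw [← hi, ← normalCone_setOf_isMax p (ha.hull_mem i)] at hwF
        intro y hy
        rw [hw]
        exact ⟨hy.1, hwF y hy⟩
      · intro y hy
        refine ⟨?_, hai y hy⟩
        rw [hw] at hy
        exact hy.1

end PerfectPairing

end NormalCones

end DeformationCone

/-! ### The theorem for polytopes and for fans. -/

theorem proposition2p13 {V W : Type*} [NormedAddCommGroup V] [NormedSpace ℝ V]
    [FiniteDimensional ℝ V] [AddCommGroup W] [Module ℝ W]
    (p : W →ₗ[ℝ] V →ₗ[ℝ] ℝ) [p.IsPerfPair] {m : ℕ} (a : Fin m → W) :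
    -- simple full-dimensional polytopes
    (∀ b₀ : Fin m → ℝ, IsFacetDescription p a b₀ → IsSimple (polyhedron p a b₀) →
      (∀ v v' : V, IsEdge (polyhedron p a b₀) v v' →
        HasUniqueWallRelation a (supportingFacets p a b₀ v) (supportingFacets p a b₀ v')) ∧
      ∀ b : Fin m → ℝ, b ∈ deformationCone p a b₀ ↔
        ∀ v v' : V, IsEdge (polyhedron p a b₀) v v' →
          WallInequality a (supportingFacets p a b₀ v) (supportingFacets p a b₀ v') b) ∧
    -- simplicial projective fans
    (∀ fan : Set (PointedCone ℝ W), IsProjectiveFan p fan → ⊥ ∈ fan → AreRayGenerators fan a →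
      IsSimplicialFan fan →
      (∀ b₀ : Fin m → ℝ, IsFacetDescription p a b₀ → normalFan p (polyhedron p a b₀) = fan →
        deformationCone p a b₀ = fanDeformationCone p fan a) ∧
      (∀ σ σ' : PointedCone ℝ W, AreAdjacent fan a σ σ' →
        HasUniqueWallRelation a (spanningRays a σ) (spanningRays a σ')) ∧
      ∀ b : Fin m → ℝ, b ∈ fanDeformationCone p fan a ↔
        ∀ σ σ' : PointedCone ℝ W, AreAdjacent fan a σ σ' →
          WallInequality a (spanningRays a σ) (spanningRays a σ') b) := by
  constructor
  · intro b₀ h hs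
    have hc := fun v (hv : IsVertex (polyhedron p a b₀) v) => h.card_supportingFacets p hs hv
    exact ⟨fun v v' he => IsEdge.hasUniqueWallRelation p he (hc v (IsEdge.isVertex_left p he))
      (hc v' (IsEdge.isVertex_right p he)),
      mem_deformationCone_iff_forall_wallInequality p h.bounded (h.nonempty p) hc
        (h.nonempty_facet p)⟩
  · rintro fan ⟨P, hne, hP, rfl⟩ hbot ha hsimp
    obtain ⟨b₁, rfl, h₁⟩ := exists_isFacetDescription p hne hP hbot ha
    have hc := fun v (hv : IsVertex (polyhedron p a b₁) v) =>
      h₁.card_supportingFacets_of_isSimplicialFan p hsimp ha hv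
    have hindep : ∀ b₀ : Fin m → ℝ, IsFacetDescription p a b₀ →
        normalFan p (polyhedron p a b₀) = normalFan p (polyhedron p a b₁) →
        deformationCone p a b₀ =
          fanDeformationCone p (normalFan p (polyhedron p a b₁)) a := by
      intro b₀ h hfan
      ext b
      refine ⟨fun hb => ⟨b₀, h, hfan, hb⟩, ?_⟩
      rintro ⟨b₂, h₂, hfan₂, hb⟩
      rw [mem_deformationCone_iff_forall_maximal p h₂, hfan₂] at hb
      rwa [mem_deformationCone_iff_forall_maximal p h, hfan]
    have hrays := fun v (hv : IsVertex (polyhedron p a b₁) v) =>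
      spanningRays_normalCone p (h₁.nonempty_facet p) hv.mem
    have hadj : ∀ σ σ', AreAdjacent (normalFan p (polyhedron p a b₁)) a σ σ' →
        ∃ v v', IsEdge (polyhedron p a b₁) v v' ∧
          spanningRays a σ = supportingFacets p a b₁ v ∧
          spanningRays a σ' = supportingFacets p a b₁ v' := by
      rintro σ σ' ⟨hσ, hσ', h, h'⟩
      obtain ⟨v, hv, rfl⟩ := (maximal_mem_normalFan_iff p h₁.bounded).1 hσ
      obtain ⟨v', hv', rfl⟩ := (maximal_mem_normalFan_iff p h₁.bounded).1 hσ'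
      rw [hrays v hv, hrays v' hv'] at h h'
      exact ⟨v, v', isEdge_of_card_sdiff p hv hv' h h', hrays v hv, hrays v' hv'⟩
    refine ⟨hindep, fun σ σ' h => ?_, fun b => ?_⟩
    · obtain ⟨v, v', he, hv, hv'⟩ := hadj σ σ' h
      rw [hv, hv']
      exact IsEdge.hasUniqueWallRelation p he (hc v (IsEdge.isVertex_left p he))
        (hc v' (IsEdge.isVertex_right p he))
    · rw [← hindep b₁ h₁ rfl, mem_deformationCone_iff_forall_wallInequality p h₁.bounded
        (h₁.nonempty p) hc (h₁.nonempty_facet p)]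
      constructor
      · intro hb σ σ' h
        obtain ⟨v, v', he, hv, hv'⟩ := hadj σ σ' h
        rw [hv, hv']
        exact hb v v' he
      -- Conversely, every edge yields a pair of adjacent cones, as each end lies on exactly one
      -- facet that misses the other.
      · intro hb v v' he
        have hv := IsEdge.isVertex_left p he
        have hv' := IsEdge.isVertex_right p he
        obtain ⟨k, hk, -⟩ := IsEdge.exists_sdiff_eq p he (hc v hv)
        obtain ⟨k', hk', -⟩ := IsEdge.exists_sdiff_eq p he.symm (hc v' hv')
        rw [← hrays v hv, ← hrays v' hv']
        refine hb _ _ ⟨(maximal_mem_normalFan_iff p h₁.bounded).2 ⟨v, hv, rfl⟩,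
          (maximal_mem_normalFan_iff p h₁.bounded).2 ⟨v', hv', rfl⟩, ?_, ?_⟩
        · rw [hrays v hv, hrays v' hv', hk, Finset.card_singleton]
        · rw [hrays v hv, hrays v' hv', hk', Finset.card_singleton]
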